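/- **Setting.** Let a finite connected graph be cellularly embedded in the (oriented) torus, with sets of vertices $V$, edges $E$ and faces $F$, and put one qubit on each edge, so that the Hilbert space is $\mathcal H=(\mathbb C^2)^{\otimes E}$. Let $A_s=\prod_{i\in\mathrm{legs}(s)}\sigma^x_i$ for $s\in V$, $B_p=\prod_{i\in\partial p}\sigma^z_i$ for $p\in F$ (an edge occurring twice among the legs of $s$, or twice in $\partial p$, drops out), and, for $U,J>0$, $H=-U\sum_sA_s-J\sum_pB_p$. A ground state is a unit eigenvector of $H$ for its lowest eigenvalue. For a set $c$ of edges write $\sigma^x(c)=\prod_{i\in c}\sigma^x_i$ and $\sigma^z(c)=\prod_{i\in c}\sigma^z_i$. Let $z_1,z_2$ be closed loops on the graph and $x_1,x_2$ closed loops on the dual graph (all mod 2), such that $x_i$ and $z_j$ cross an even number of times if $i=j$ and an odd number of times if $i\ne j$; so $z_1,z_2$ are independent non-contractible loops ("vertical" and "horizontal") and $x_i$ winds in the same direction as $z_i$. Put $W^z_i=\sigma^z(z_i)$, $W^x_i=\sigma^x(x_i)$. The definite-flux states are $$|\psi_{\mathbb 1}\rangle=N\prod_{p}\frac{\mathbb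 1+B_p}{2}\;\frac{\mathbb 1+W^z_1}{2}\,|{+}\cdots{+}\rangle,\qquad |\psi_e\rangle=W^x_2|\psi_{\mathbb 1}\rangle,\quad |\psi_m\rangle=W^z_2|\psi_{\mathbb 1}\rangle,\quad |\psi_{em}\rangle=W^x_2W^z_2|\psi_{\mathbb 1}\rangle,$$ where $N>0$ normalizes $|\psi_{\mathbb 1}\rangle$. **Regions.** Let $E=A\sqcup B$. A corner (of a face $p$ at a vertex $s$) is cut if the two edges that meet in it lie in different regions; the boundary between $A$ and $B$ is the curve that runs alternately through stars and plaquettes, passing from one to the other through the cut corners. Assume that $A$ and $B$ are non-contractible in the vertical direction, i.e. each contains a closed loop of the graph homologous mod 2 to $z_1$, that the boundary does not touch itself (at most two cut corners around each vertex and at most two around each face), and that it has exactly two connected components. Let $n^{(1)}_{AB}$ and $n^{(2)}_{AB}$ be the numbers of plaquettes that the first and the second component run through, and put $\mu_{\max}=2^{n^{(1)}_{AB}-1}$, $\gamma_{\max}=2^{n^{(2)}_{AB}-1}$. **Statement.** There are vectors $|e^{(\psi_i)}_{\mu\gamma}\rangle\in(\mathbb C^2)^{\otimes A}$ and $|f^{(\psi_i)}_{\mu\gamma}\rangle\in(\mathbb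 C^2)^{\otimes B}$, for $i\in\{\mathbb 1,e,m,em\}$, $1\le\mu\le\mu_{\max}$, $1\le\gamma\le\gamma_{\max}$, with $$\langle e^{(\psi_{i'})}_{\mu'\gamma'}|e^{(\psi_i)}_{\mu\gamma}\rangle=\langle f^{(\psi_{i'})}_{\mu'\gamma'}|f^{(\psi_i)}_{\mu\gamma}\rangle=\delta_{\mu\mu'}\delta_{\gamma\gamma'}\delta_{ii'},$$ such that: 1. for every $i$, $\;|\psi_i\rangle=\mu_{\max}^{-1/2}\gamma_{\max}^{-1/2}\sum_{\mu=1}^{\mu_{\max}}\sum_{\gamma=1}^{\gamma_{\max}}|e^{(\psi_i)}_{\mu\gamma}\rangle_A\otimes|f^{(\psi_i)}_{\mu\gamma}\rangle_B$; 2. every $|\psi_i\rangle$ is a ground state (for all $U,J>0$) and is an eigenvector of $W^z_1$ and $W^x_1$, with eigenvalues $(+1,+1)$, $(-1,+1)$, $(+1,-1)$, $(-1,-1)$ for $i=\mathbb 1,e,m,em$ respectively; 3. for all $U,J>0$, every ground state $|\psi\rangle$ can be written as $|\psi\rangle=\sum_i c_i|\psi_i\rangle$ with $\sum_i|c_i|^2=1$,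 and then $$|\psi\rangle=\sum_{i}c_i\sum_{\mu=1}^{\mu_{\max}}\sum_{\gamma=1}^{\gamma_{\max}}\mu_{\max}^{-1/2}\gamma_{\max}^{-1/2}\,|e^{(\psi_i)}_{\mu\gamma}\rangle_A\otimes|f^{(\psi_i)}_{\mu\gamma}\rangle_B .$$ -/

import Mathlib

open scoped BigOperators

noncomputable section

/-- A finite graph cellularly embedded in the torus, as a rotation system on the set `D` of darts
(half-edges). `rot` turns a dart to the counterclockwise next dart at the same vertex and `opp`
sends a dart to the other half of its edge. Vertices, edges and faces are the cycles of `rot`, of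
`opp` and of `rot⁻¹ * opp` (the walk that keeps its face on the left). A connected rotation system
is a cellulation of a closed oriented surface; the surface is the torus iff `V - E + F = 0`. -/
structure TorusLattice (D : Type*) [Fintype D] where
  rot : Equiv.Perm D
  opp : Equiv.Perm D
  nonempty : Nonempty D
  opp_opp : ∀ d, opp (opp d) = d
  opp_ne : ∀ d, opp d ≠ d
  connected : ∀ d d' : D, ∃ g ∈ Subgroup.closure {rot, opp}, g d = d'
  euler : Nat.card (Quotient (Equiv.Perm.SameCycle.setoid rot)) +
      Nat.card (Quotient (Equiv.Perm.SameCycle.setoid (rot⁻¹ * opp))) =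
    Nat.card (Quotient (Equiv.Perm.SameCycle.setoid opp))

namespace TorusLattice

variable {D : Type*} [Fintype D] (T : TorusLattice D)

/-! ### Cells -/

def Vertex : Type _ := Quotient (Equiv.Perm.SameCycle.setoid T.rot)
def Edge : Type _ := Quotient (Equiv.Perm.SameCycle.setoid T.opp)
def Face : Type _ := Quotient (Equiv.Perm.SameCycle.setoid (T.rot⁻¹ * T.opp))

/-- The vertex at which a dart is based. -/
def vertexOf (d : D) : T.Vertex := Quotient.mk (Equiv.Perm.SameCycle.setoid T.rot) d
/-- The edge to which a dart belongs. -/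
def edgeOf (d : D) : T.Edge := Quotient.mk (Equiv.Perm.SameCycle.setoid T.opp) d
/-- The face to the left of a dart. -/
def faceOf (d : D) : T.Face := Quotient.mk (Equiv.Perm.SameCycle.setoid (T.rot⁻¹ * T.opp)) d

instance : Finite T.Vertex := inferInstanceAs (Finite (Quotient _))
instance : Finite T.Edge := inferInstanceAs (Finite (Quotient _))
instance : Finite T.Face := inferInstanceAs (Finite (Quotient _))
instance : Fintype T.Vertex := Fintype.ofFinite _
instance : Fintype T.Edge := Fintype.ofFinite _
instance : Fintype T.Face := Fintype.ofFinite _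
instance : DecidableEq T.Vertex := Classical.decEq _
instance : DecidableEq T.Edge := Classical.decEq _
instance : DecidableEq T.Face := Classical.decEq _

/-! ### Mod 2 chains of edges -/

/-- Sets of edges, as mod 2 chains. -/
abbrev Chain : Type _ := T.Edge → ZMod 2

/-- The legs of a vertex: each edge counted (mod 2) as often as it has an end at `v`. -/
def legs (v : T.Vertex) : T.Chain := fun e =>
  ((Nat.card {d : D // T.vertexOf d = v ∧ T.edgeOf d = e} : ℕ) : ZMod 2)

/-- The boundary of a face: each edge counted (mod 2) as often as the boundary walk uses it. -/
def bdry (f : T.Face) : T.Chain := fun e =>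
  ((Nat.card {d : D // T.faceOf d = f ∧ T.edgeOf d = e} : ℕ) : ZMod 2)

/-- The parity of the number of common edges. -/
def pairing (c c' : T.Chain) : ZMod 2 := ∑ e, c e * c' e

/-- Closed loops on the graph: every vertex is met an even number of times. -/
def IsLoop (c : T.Chain) : Prop := ∀ v, T.pairing (T.legs v) c = 0

/-- Closed loops on the dual graph: every face boundary is crossed an even number of times. -/
def IsDualLoop (c : T.Chain) : Prop := ∀ f, T.pairing (T.bdry f) c = 0

/-- Two chains differ by a sum of face boundaries. -/
def Homologous (c c' : T.Chain) : Prop :=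
  ∃ S : T.Face → ZMod 2, c = c' + ∑ f, S f • T.bdry f

/-- A choice of the non-contractible loops supporting `W^z₁, W^z₂` (loops on the graph) and
`W^x₁, W^x₂` (loops on the dual graph). Loops with the same index wind around the torus in the same
direction (`1` vertical, `2` horizontal) and cross evenly, loops of different index cross oddly.
These crossing numbers say that `z₁, z₂` are independent in mod 2 homology and that the dual loop
`xᵢ` is in the class of `zᵢ`. -/
structure LoopSystem where
  z₁ : T.Chain
  z₂ : T.Chain
  x₁ : T.Chain
  x₂ : T.Chain
  loop_z₁ : T.IsLoop z₁
  loop_z₂ : T.IsLoop z₂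
  loop_x₁ : T.IsDualLoop x₁
  loop_x₂ : T.IsDualLoop x₂
  cross₁₁ : T.pairing x₁ z₁ = 0
  cross₂₂ : T.pairing x₂ z₂ = 0
  cross₁₂ : T.pairing x₁ z₂ = 1
  cross₂₁ : T.pairing x₂ z₁ = 1

/-! ### Qubits on the edges -/

/-- The Hilbert space `(ℂ²)^{⊗ n}` of one qubit per edge, in coordinates with respect to the
computational (`σ^z`) basis, which is indexed by the configurations `s : Edge → {0, 1}`. -/
abbrev Hilb : Type _ := EuclideanSpace ℂ (T.Edge → ZMod 2)

/-- The Hilbert space of the qubits in the region `R`. -/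
abbrev RegionHilb (R : Finset T.Edge) : Type _ :=
  EuclideanSpace ℂ ({e : T.Edge // e ∈ R} → ZMod 2)

/-- The vector `a ⊗ b` for `a` in the Hilbert space of `A` and `b` in that of the complement. -/
def tensor (A : Finset T.Edge) (a : T.RegionHilb A) (b : T.RegionHilb Aᶜ) : T.Hilb :=
  WithLp.toLp 2 fun s => a (fun e => s e) * b (fun e => s e)

/-- The product of the Pauli operators `σ^x` over the edges in `c`: flips the bits in `c`. -/
def xString (c : T.Chain) : Module.End ℂ T.Hilb where
  toFun ψ := WithLp.toLp 2 fun s => ψ (s + c)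
  map_add' _ _ := rfl
  map_smul' _ _ := rfl

/-- The product of the Pauli operators `σ^z` over the edges in `c`: multiplies the basis vector
`s` by `(-1)^{s(c)}`. -/
def zString (c : T.Chain) : Module.End ℂ T.Hilb where
  toFun ψ := WithLp.toLp 2 fun s => (-1 : ℂ) ^ (T.pairing c s).val * ψ s
  map_add' ψ φ := by ext s; simp [mul_add]
  map_smul' a ψ := by ext s; simp [mul_left_comm]

/-- The star operator `A_s`. -/
def starOp (v : T.Vertex) : Module.End ℂ T.Hilb := T.xString (T.legs v)

/-- The plaquette operator `B_p`. -/
def plaqOp (f : T.Face) : Module.End ℂ T.Hilb := T.zString (T.bdry f)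

/-- The toric code Hamiltonian. -/
def hamiltonian (U J : ℝ) : Module.End ℂ T.Hilb :=
  -(U : ℂ) • ∑ v, T.starOp v - (J : ℂ) • ∑ f, T.plaqOp f

/-- Normalized eigenvectors for the lowest eigenvalue of the Hamiltonian. -/
def IsGroundState (U J : ℝ) (ψ : T.Hilb) : Prop :=
  ‖ψ‖ = 1 ∧ ∃ E₀ : ℝ, T.hamiltonian U J ψ = (E₀ : ℂ) • ψ ∧
    ∀ E : ℝ, (T.hamiltonian U J).HasEigenvalue (E : ℂ) → E₀ ≤ E

/-- The vector `|+⋯+⟩`. -/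
def plusState : T.Hilb := WithLp.toLp 2 fun _ => ((Real.sqrt 2 : ℂ)⁻¹) ^ Fintype.card T.Edge

/-- The operator `(1 + W) / 2`. -/
def halfProj (W : Module.End ℂ T.Hilb) : Module.End ℂ T.Hilb := (2⁻¹ : ℂ) • (1 + W)

theorem commute_halfProj_plaqOp (f g : T.Face) :
    Commute (T.halfProj (T.plaqOp f)) (T.halfProj (T.plaqOp g)) := by
  have h : Commute (T.plaqOp f) (T.plaqOp g) := by
    refine LinearMap.ext fun ψ => ?_
    ext s
    simp [plaqOp, zString, mul_left_comm]
  unfold halfProj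
  exact ((((Commute.one_right _).add_right ((Commute.one_left _).add_left h)).smul_left
    (2⁻¹ : ℂ)).smul_right (2⁻¹ : ℂ))

/-- The vector `∏_p (1 + B_p)/2 · (1 + W^z₁)/2 |+⋯+⟩`, before normalization. The product over all
plaquettes equals the product over all but one of them, because the product of all `B_p` is `1`. -/
def fluxVacuum (W : T.LoopSystem) : T.Hilb :=
  (Finset.univ.noncommProd (fun f => T.halfProj (T.plaqOp f))
    fun f _ g _ _ => T.commute_halfProj_plaqOp f g)
    (T.halfProj (T.zString W.z₁) T.plusState)

end TorusLattice

/-- The anyon fluxes through the interior of the torus. -/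
inductive Flux
  | one | e | m | em
  deriving DecidableEq

instance : Fintype Flux := ⟨{.one, .e, .m, .em}, fun i => by cases i <;> simp⟩

namespace TorusLattice

variable {D : Type*} [Fintype D] (T : TorusLattice D)

/-- The ground states `|ψ_i⟩` of definite flux. -/
def fluxState (W : T.LoopSystem) : Flux → T.Hilb
  | .one => ((‖T.fluxVacuum W‖⁻¹ : ℝ) : ℂ) • T.fluxVacuum W
  | .e => T.xString W.x₂ (((‖T.fluxVacuum W‖⁻¹ : ℝ) : ℂ) • T.fluxVacuum W)
  | .m => T.zString W.z₂ (((‖T.fluxVacuum W‖⁻¹ : ℝ) : ℂ) • T.fluxVacuum W)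
  | .em => T.xString W.x₂ (T.zString W.z₂ (((‖T.fluxVacuum W‖⁻¹ : ℝ) : ℂ) • T.fluxVacuum W))

/-- The eigenvalue of `W^z₁` in the state of flux `i`. -/
def fluxZ : Flux → ℂ
  | .one => 1
  | .e => -1
  | .m => 1
  | .em => -1

/-- The eigenvalue of `W^x₁` in the state of flux `i`. -/
def fluxX : Flux → ℂ
  | .one => 1
  | .e => 1
  | .m => -1
  | .em => -1

/-! ### Regions -/

/-- A region of the torus is non-contractible, in the direction of the loop `z`, if it contains a
loop homologous to `z`. -/
def WindsAlong (z : T.Chain) (R : Finset T.Edge) : Prop :=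
  ∃ c : T.Chain, T.IsLoop c ∧ (∀ e, e ∉ R → c e = 0) ∧ T.Homologous c z

/-- The dart `d` also names the corner between the edges of `d` and `rot d`, which lies at the
vertex `vertexOf d` and in the face `faceOf d`. The corner is cut by the boundary between `A` and
its complement if these two edges lie in different regions. -/
def IsCut (A : Finset T.Edge) (d : D) : Prop :=
  ¬ (T.edgeOf d ∈ A ↔ T.edgeOf (T.rot d) ∈ A)

/-- The boundary between `A` and its complement, drawn as a graph: it runs through the centres of
stars and of plaquettes and passes from one to the other through the cut corners. -/
def boundaryGraph (A : Finset T.Edge) : SimpleGraph (T.Vertex ⊕ T.Face) :=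
  SimpleGraph.fromRel fun a b =>
    ∃ d : D, T.IsCut A d ∧ a = Sum.inl (T.vertexOf d) ∧ b = Sum.inr (T.faceOf d)

/-- The component of the boundary that runs through the face `f`. -/
abbrev boundaryAt (A : Finset T.Edge) (f : T.Face) : (T.boundaryGraph A).ConnectedComponent :=
  (T.boundaryGraph A).connectedComponentMk (Sum.inr f)

/-- The number of plaquettes spanning the boundary component `Γ`. -/
def numPlaquettes (A : Finset T.Edge) (Γ : (T.boundaryGraph A).ConnectedComponent) : ℕ :=
  Nat.card {f : T.Face // T.boundaryAt A f = Γ}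

/-- `A` and its complement `B` are non-contractible regions (winding along `z`) whose common
boundary consists of exactly two closed curves, `Γ₁` and `Γ₂`, which touch neither themselves nor
each other: around each star and around each plaquette, the boundary cuts at most two corners. -/
structure IsAnnularBipartition (z : T.Chain) (A : Finset T.Edge)
    (Γ₁ Γ₂ : (T.boundaryGraph A).ConnectedComponent) : Prop where
  winds_left : T.WindsAlong z A
  winds_right : T.WindsAlong z Aᶜ
  simple_vertex : ∀ v, Nat.card {d : D // T.vertexOf d = v ∧ T.IsCut A d} ≤ 2
  simple_face : ∀ f, Nat.card {d : D // T.faceOf d = f ∧ T.IsCut A d} ≤ 2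
  ne : Γ₁ ≠ Γ₂
  two : {Γ | ∃ d, T.IsCut A d ∧ T.boundaryAt A (T.faceOf d) = Γ} = {Γ₁, Γ₂}

end TorusLattice

end

noncomputable section

/-! ### Signs and signed indicator vectors of cosets -/

/-! Write `K` for `W.fluxGroup`, the dual loops that cross `z₁` evenly. In the σ^z basis the flux
vacuum is the uniform superposition of `K`; `W^x₂` translates `K` to the coset `x₂ + K`, and `W^z₂`
inserts the sign given by the crossing number with `z₂` (`fluxState_eq`). The Euler characteristic
shows that dual loops are spanned by stars, `x₁` and `x₂` (`exists_eq_of_isDualLoop`), so `K` is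
generated by stars and `x₁`.

Let `K_A` and `K_B` be the elements of `K` supported on the two regions. Splitting `K` into cosets
of `K_A + K_B` writes each state as an equal-weight sum of products of signed coset superpositions
(`IsTransversal.stateVec_eq`). The cosets are counted by `cutMap`, which sends `k` to the plaquettes
violated by its restriction to `A`. Its kernel in `K` is `K_A + K_B`, because a dual loop inside `A`
misses the copy of `z₁` in `B`. Its image consists of the sets of boundary plaquettes that are even
on each component: a star on the boundary flips the plaquettes at its two cut corners, and `x₁` adds
nothing because modulo stars it fits inside `A`. This gives the Schmidt rank (`card_map_cutMap`).

Orthogonality across fluxes holds because each region detects the flux by itself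
(`inner_regionVec`): the charge through a loop of class `z₁` in the region, the vortex through a
dual loop of class `x₁` there. The latter comes from pushing the loop onto the dual graph inside its
region (`exists_push`), the main geometric step.

The Hamiltonian is frustration free, so its ground states are the unit vectors of `codeSpace`, where
a vector is fixed by its values at the four configurations `a • x₁ + b • x₂`. -/

/-- The sign `(-1)^x`. -/
def parity (x : ZMod 2) : ℂ := (-1) ^ x.val

theorem ZMod.two_cases (x : ZMod 2) : x = 0 ∨ x = 1 := by
  revert x; decide

@[simp] theorem parity_zero : parity 0 = 1 := by simp [parity]

@[simp] theorem parity_one : parity 1 = -1 := by simp [parity, ZMod.val_one]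

theorem parity_add (x y : ZMod 2) : parity (x + y) = parity x * parity y := by
  rcases ZMod.two_cases x with rfl | rfl <;> rcases ZMod.two_cases y with rfl | rfl <;>
    simp [CharTwo.add_self_eq_zero]

theorem star_parity (x : ZMod 2) : (starRingEnd ℂ) (parity x) = parity x := by
  simp [parity]

theorem add_self_of_zmod_two {G : Type*} [AddCommGroup G] [Module (ZMod 2) G] (x : G) :
    x + x = 0 := by
  rw [← two_smul (ZMod 2) x, show (2 : ZMod 2) = 0 from rfl, zero_smul]

section CosetVec

variable {G : Type*} [AddCommGroup G] [Module (ZMod 2) G]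

open Classical in
/-- The normalized superposition of the elements of the coset `u + L`, with signs `(-1)^χ`. -/
def cosetVec (L : Submodule (ZMod 2) G) (χ : G →ₗ[ZMod 2] ZMod 2) (u : G) : EuclideanSpace ℂ G :=
  WithLp.toLp 2 fun a =>
    (((√(Nat.card L))⁻¹ : ℝ) : ℂ) * parity (χ a) * if a + u ∈ L then 1 else 0

variable (L : Submodule (ZMod 2) G) (χ χ' : G →ₗ[ZMod 2] ZMod 2) (u u' : G)

open Classical in
theorem cosetVec_apply (a : G) : cosetVec L χ u a =
    (((√(Nat.card L))⁻¹ : ℝ) : ℂ) * parity (χ a) * if a + u ∈ L then 1 else 0 := rfl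

variable [Fintype G]

open Classical in
theorem inner_cosetVec : inner ℂ (cosetVec L χ' u') (cosetVec L χ u) =
    ∑ a, (((Nat.card L : ℝ)⁻¹ : ℝ) : ℂ) * parity ((χ + χ') a) *
      if a + u ∈ L ∧ a + u' ∈ L then 1 else 0 := by
  rw [PiLp.inner_apply]
  refine Finset.sum_congr rfl fun a _ => ?_
  have h : (((√(Nat.card L))⁻¹ : ℝ) : ℂ) * (((√(Nat.card L))⁻¹ : ℝ) : ℂ) =
      (((Nat.card L : ℝ)⁻¹ : ℝ) : ℂ) := by
    rw [← Complex.ofReal_mul, ← mul_inv, Real.mul_self_sqrt (Nat.cast_nonneg _)]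
  rw [RCLike.inner_apply, cosetVec_apply, cosetVec_apply, map_mul, map_mul, star_parity,
    Complex.conj_ofReal, LinearMap.add_apply, parity_add, ← h]
  by_cases h1 : a + u ∈ L <;> by_cases h2 : a + u' ∈ L <;> simp [h1, h2]
  ring

theorem inner_cosetVec_self : inner ℂ (cosetVec L χ u) (cosetVec L χ u) = 1 := by
  classical
  rw [inner_cosetVec]
  have h : ∀ a, (χ + χ) a = 0 := fun a => by
    rw [LinearMap.add_apply, CharTwo.add_self_eq_zero]
  simp only [h, parity_zero, mul_one, and_self]
  rw [← Finset.mul_sum, Finset.sum_boole]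
  have hc : (Finset.univ.filter fun a => a + u ∈ L).card = Nat.card L := by
    rw [← Fintype.card_subtype, ← Nat.card_eq_fintype_card]
    exact Nat.card_congr ((Equiv.addRight u).subtypeEquiv fun a => Iff.rfl)
  rw [hc]
  have : (Nat.card L : ℂ) ≠ 0 := by
    exact_mod_cast Nat.card_pos.ne'
  push_cast
  exact inv_mul_cancel₀ this

theorem norm_cosetVec : ‖cosetVec L χ u‖ = 1 := by
  rw [@norm_eq_sqrt_re_inner ℂ, inner_cosetVec_self]
  simp

variable {L u u' χ χ'}

/-- The two cosets are disjoint. -/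
theorem inner_cosetVec_of_notMem (h : u + u' ∉ L) :
    inner ℂ (cosetVec L χ' u') (cosetVec L χ u) = 0 := by
  classical
  rw [inner_cosetVec]
  refine Finset.sum_eq_zero fun a _ => ?_
  rw [if_neg, mul_zero]
  rintro ⟨h1, h2⟩
  refine h ?_
  have := L.add_mem h1 h2
  rwa [add_add_add_comm, add_self_of_zmod_two, zero_add] at this

/-- Translation by `y` preserves both supports and reverses the sign of every term, so the overlap
equals its own negative. -/
theorem inner_cosetVec_of_ne {y : G} (hy : y ∈ L) (h : (χ + χ') y = 1) :
    inner ℂ (cosetVec L χ' u') (cosetVec L χ u) = 0 := by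
  classical
  rw [inner_cosetVec, ← self_eq_neg, ← Finset.sum_neg_distrib]
  refine Fintype.sum_equiv (Equiv.addRight y) _ _ fun a => ?_
  have h' : ∀ w, a + y + w ∈ L ↔ a + w ∈ L := fun w => by
    rw [add_right_comm]; exact L.add_mem_iff_left hy
  simp only [Equiv.coe_addRight, h', map_add, h, parity_add, parity_one]
  ring

end CosetVec

namespace TorusLattice

variable {D : Type*} [Fintype D] (T : TorusLattice D)

/-! ### Incidences -/

@[simp] theorem vertexOf_rot (d : D) : T.vertexOf (T.rot d) = T.vertexOf d :=
  Quotient.sound ((Equiv.Perm.sameCycle_apply_left (f := T.rot)).2 (Equiv.Perm.SameCycle.refl _ _))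

@[simp] theorem edgeOf_opp (d : D) : T.edgeOf (T.opp d) = T.edgeOf d :=
  Quotient.sound ((Equiv.Perm.sameCycle_apply_left (f := T.opp)).2 (Equiv.Perm.SameCycle.refl _ _))

theorem faceOf_next (d : D) : T.faceOf (T.rot⁻¹ (T.opp d)) = T.faceOf d :=
  Quotient.sound ((Equiv.Perm.sameCycle_apply_left (f := T.rot⁻¹ * T.opp)).2
    (Equiv.Perm.SameCycle.refl _ _))

@[simp] theorem faceOf_opp_rot (d : D) : T.faceOf (T.opp (T.rot d)) = T.faceOf d := by
  rw [← faceOf_next, T.opp_opp, Equiv.Perm.inv_def, Equiv.symm_apply_apply]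

theorem edgeOf_eq_iff {d d' : D} : T.edgeOf d' = T.edgeOf d ↔ d' = d ∨ d' = T.opp d := by
  constructor
  · intro h
    obtain ⟨i, hi⟩ : T.opp.SameCycle d d' := (Quotient.exact h).symm
    have h2 : T.opp ^ (2 : ℤ) = 1 := by
      ext x; rw [zpow_two]; exact T.opp_opp x
    rcases Int.even_or_odd' i with ⟨k, rfl | rfl⟩
    · left; rw [← hi, zpow_mul, h2, one_zpow, Equiv.Perm.one_apply]
    · right; rw [← hi, zpow_add, zpow_mul, h2, one_zpow, one_mul, zpow_one]
  · rintro (rfl | rfl)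
    · rfl
    · exact T.edgeOf_opp d

/-- The form in which connectedness is used: it makes the kernels of `bdrySum` and `starSum` consist
of constants. -/
theorem eq_of_invariant {α : Type*} (φ : D → α) (hr : ∀ d, φ (T.rot d) = φ d)
    (ho : ∀ d, φ (T.opp d) = φ d) (d d' : D) : φ d = φ d' := by
  obtain ⟨g, hg, rfl⟩ := T.connected d d'
  suffices h : ∀ d, φ (g d) = φ d from (h d).symm
  induction hg using Subgroup.closure_induction with
  | mem x hx =>
    rcases hx with rfl | rfl
    · exact hr
    · exact ho
  | one => intro d; rfl
  | mul x y _ _ hx hy => intro d; rw [Equiv.Perm.mul_apply, hx, hy]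
  | inv x _ hx => intro d; rw [← hx (x⁻¹ d), Equiv.Perm.inv_def, Equiv.apply_symm_apply]

theorem vertexOf_surjective : Function.Surjective T.vertexOf := Quotient.mk_surjective
theorem edgeOf_surjective : Function.Surjective T.edgeOf := Quotient.mk_surjective
theorem faceOf_surjective : Function.Surjective T.faceOf := Quotient.mk_surjective

/-! ### Mod 2 crossing numbers -/

theorem pairing_eq (c c' : T.Chain) : T.pairing c c' = c ⬝ᵥ c' := rfl

theorem pairing_comm (c c' : T.Chain) : T.pairing c c' = T.pairing c' c :=
  dotProduct_comm c c'

theorem pairing_add_right (a b c : T.Chain) :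
    T.pairing a (b + c) = T.pairing a b + T.pairing a c := dotProduct_add a b c

theorem pairing_smul_right (x : ZMod 2) (a b : T.Chain) :
    T.pairing a (x • b) = x * T.pairing a b := dotProduct_smul x a b

theorem pairing_sum_smul_right {ι : Type*} [Fintype ι] (a : T.Chain) (x : ι → ZMod 2)
    (b : ι → T.Chain) : T.pairing a (∑ i, x i • b i) = ∑ i, x i * T.pairing a (b i) := by
  simp only [pairing_eq, dotProduct_sum, dotProduct_smul, smul_eq_mul]

/-- The linear functional `s ↦ s(c)`. -/
def pairingHom (c : T.Chain) : T.Chain →ₗ[ZMod 2] ZMod 2 where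
  toFun s := T.pairing c s
  map_add' := T.pairing_add_right c
  map_smul' x s := T.pairing_smul_right x c s

@[simp] theorem pairingHom_apply (c s : T.Chain) : T.pairingHom c s = T.pairing c s := rfl

open Classical in
theorem pairing_count {α : Type*} (k : D → α) (v : α) (h : T.Chain) :
    ∑ e, ((Nat.card {d : D // k d = v ∧ T.edgeOf d = e} : ℕ) : ZMod 2) * h e =
      ∑ d, if k d = v then h (T.edgeOf d) else 0 := by
  have h1 : ∀ e, ((Nat.card {d : D // k d = v ∧ T.edgeOf d = e} : ℕ) : ZMod 2) * h e =
      ∑ d, if k d = v ∧ T.edgeOf d = e then h e else 0 := fun e => by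
    rw [Nat.card_eq_fintype_card, Fintype.card_subtype, ← Finset.sum_boole, Finset.sum_mul]
    simp
  simp only [h1]
  rw [Finset.sum_comm]
  refine Finset.sum_congr rfl fun d _ => ?_
  simp only [ite_and]
  by_cases hd : k d = v <;> simp [hd]

open Classical in
theorem pairing_legs (v : T.Vertex) (h : T.Chain) :
    T.pairing (T.legs v) h = ∑ d, if T.vertexOf d = v then h (T.edgeOf d) else 0 :=
  T.pairing_count T.vertexOf v h

open Classical in
theorem pairing_bdry (f : T.Face) (h : T.Chain) :
    T.pairing (T.bdry f) h = ∑ d, if T.faceOf d = f then h (T.edgeOf d) else 0 :=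
  T.pairing_count T.faceOf f h

open Classical in
theorem count_edgeOf {α : Type*} (k : D → α) (v : α) (d : D) :
    ((Nat.card {d' : D // k d' = v ∧ T.edgeOf d' = T.edgeOf d} : ℕ) : ZMod 2) =
      (if k d = v then 1 else 0) + if k (T.opp d) = v then 1 else 0 := by
  rw [Nat.card_eq_fintype_card, Fintype.card_subtype, ← Finset.sum_boole]
  rw [← Finset.sum_subset (Finset.subset_univ {d, T.opp d})]
  · rw [Finset.sum_pair (T.opp_ne d).symm]
    simp
  · intro x _ hx
    rw [if_neg]
    rintro ⟨-, h⟩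
    rw [edgeOf_eq_iff] at h
    simp [h] at hx

open Classical in
theorem bdry_edgeOf (f : T.Face) (d : D) : T.bdry f (T.edgeOf d) =
    (if T.faceOf d = f then 1 else 0) + if T.faceOf (T.opp d) = f then 1 else 0 :=
  T.count_edgeOf T.faceOf f d

open Classical in
theorem legs_edgeOf (v : T.Vertex) (d : D) : T.legs v (T.edgeOf d) =
    (if T.vertexOf d = v then 1 else 0) + if T.vertexOf (T.opp d) = v then 1 else 0 :=
  T.count_edgeOf T.vertexOf v d

/-! ### Boundaries, coboundaries and restriction to a region -/

/-- The boundary of a set of faces. -/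
def bdrySum : (T.Face → ZMod 2) →ₗ[ZMod 2] T.Chain := Fintype.linearCombination (ZMod 2) T.bdry

/-- The coboundary of a set of vertices. -/
def starSum : (T.Vertex → ZMod 2) →ₗ[ZMod 2] T.Chain := Fintype.linearCombination (ZMod 2) T.legs

theorem bdrySum_apply (S : T.Face → ZMod 2) : T.bdrySum S = ∑ f, S f • T.bdry f := rfl
theorem starSum_apply (S : T.Vertex → ZMod 2) : T.starSum S = ∑ v, S v • T.legs v := rfl

theorem bdrySum_edgeOf (S : T.Face → ZMod 2) (d : D) :
    T.bdrySum S (T.edgeOf d) = S (T.faceOf d) + S (T.faceOf (T.opp d)) := by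
  classical
  simp [bdrySum_apply, Finset.sum_apply, bdry_edgeOf, mul_add, Finset.sum_add_distrib]

theorem starSum_edgeOf (S : T.Vertex → ZMod 2) (d : D) :
    T.starSum S (T.edgeOf d) = S (T.vertexOf d) + S (T.vertexOf (T.opp d)) := by
  classical
  simp [starSum_apply, Finset.sum_apply, legs_edgeOf, mul_add, Finset.sum_add_distrib]

/-- The restriction of a chain to a region, extended by zero. -/
def mask (R : Finset T.Edge) : T.Chain →ₗ[ZMod 2] T.Chain where
  toFun c e := if e ∈ R then c e else 0
  map_add' a b := by ext e; by_cases h : e ∈ R <;> simp [h]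
  map_smul' a b := by ext e; by_cases h : e ∈ R <;> simp [h]

theorem mask_apply (R : Finset T.Edge) (c : T.Chain) (e : T.Edge) :
    T.mask R c e = if e ∈ R then c e else 0 := rfl

theorem mask_add_mask_compl (R : Finset T.Edge) (c : T.Chain) :
    T.mask R c + T.mask Rᶜ c = c := by
  ext e; by_cases h : e ∈ R <;> simp [mask_apply, h]

theorem pairing_mask_comm (R : Finset T.Edge) (a b : T.Chain) :
    T.pairing a (T.mask R b) = T.pairing (T.mask R a) b :=
  Finset.sum_congr rfl fun e _ => by by_cases h : e ∈ R <;> simp [mask_apply, h]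

theorem mask_eq_self {R : Finset T.Edge} {c : T.Chain} (h : ∀ e, e ∉ R → c e = 0) :
    T.mask R c = c := by
  ext e; by_cases he : e ∈ R <;> simp [mask_apply, he, h]

theorem mask_compl_eq_zero {R : Finset T.Edge} {c : T.Chain} (h : ∀ e, e ∉ R → c e = 0) :
    T.mask Rᶜ c = 0 := by
  ext e; by_cases he : e ∈ R <;> simp [mask_apply, he, h]

/-- Within the face `f`, the star of `v` restricted to `R` is met once for each cut corner of `f`
at `v`. -/
theorem pairing_bdry_mask_legs (R : Finset T.Edge) (f : T.Face) (v : T.Vertex) :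
    T.pairing (T.bdry f) (T.mask R (T.legs v)) =
      ((Nat.card {d : D // T.vertexOf d = v ∧ T.faceOf d = f ∧ T.IsCut R d} : ℕ) : ZMod 2) := by
  classical
  rw [pairing_comm, ← pairing_mask_comm, pairing_legs]
  have h1 : ∀ d, (if T.vertexOf d = v then T.mask R (T.bdry f) (T.edgeOf d) else 0) =
      (if T.vertexOf d = v ∧ T.faceOf d = f ∧ T.edgeOf d ∈ R then 1 else 0) +
      (if T.vertexOf d = v ∧ T.faceOf (T.opp d) = f ∧ T.edgeOf d ∈ R then 1 else 0) := fun d => by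
    by_cases hv : T.vertexOf d = v <;> by_cases he : T.edgeOf d ∈ R <;>
      simp [hv, he, mask_apply, bdry_edgeOf]
  simp only [h1]
  -- Shifting by `rot` moves the face to the right of a dart onto the preceding corner. Each corner
  -- then gets one term from each of its two edges, and these cancel mod 2 unless exactly one edge
  -- lies in `R`.
  rw [Finset.sum_add_distrib, ← Equiv.sum_comp T.rot (fun d =>
    if T.vertexOf d = v ∧ T.faceOf (T.opp d) = f ∧ T.edgeOf d ∈ R then (1 : ZMod 2) else 0),
    ← Finset.sum_add_distrib, Nat.card_eq_fintype_card, Fintype.card_subtype, ← Finset.sum_boole]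
  refine Finset.sum_congr rfl fun d _ => ?_
  rw [vertexOf_rot, faceOf_opp_rot]
  by_cases hv : T.vertexOf d = v <;> by_cases hf : T.faceOf d = f <;>
    by_cases he : T.edgeOf d ∈ R <;> by_cases he' : T.edgeOf (T.rot d) ∈ R <;>
    simp [hv, hf, he, he', IsCut, CharTwo.add_self_eq_zero]

theorem pairing_bdry_legs (f : T.Face) (v : T.Vertex) : T.pairing (T.bdry f) (T.legs v) = 0 := by
  have h := T.pairing_bdry_mask_legs Finset.univ f v
  rw [T.mask_eq_self (fun e he => absurd (Finset.mem_univ e) he)] at h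
  rw [h]
  have : IsEmpty {d : D // T.vertexOf d = v ∧ T.faceOf d = f ∧ T.IsCut Finset.univ d} :=
    ⟨fun x => x.2.2.2 (by simp)⟩
  simp

theorem isDualLoop_starSum (S : T.Vertex → ZMod 2) : T.IsDualLoop (T.starSum S) := fun f => by
  rw [starSum_apply, pairing_sum_smul_right]
  simp [pairing_bdry_legs]

theorem pairing_bdrySum {k : T.Chain} (hk : T.IsDualLoop k) (S : T.Face → ZMod 2) :
    T.pairing k (T.bdrySum S) = 0 := by
  rw [bdrySum_apply, pairing_sum_smul_right]
  exact Finset.sum_eq_zero fun f _ => by rw [pairing_comm, hk f, mul_zero]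

theorem pairing_starSum {c : T.Chain} (hc : T.IsLoop c) (S : T.Vertex → ZMod 2) :
    T.pairing c (T.starSum S) = 0 := by
  rw [starSum_apply, pairing_sum_smul_right]
  exact Finset.sum_eq_zero fun f _ => by rw [pairing_comm, hc f, mul_zero]

theorem pairing_of_homologous {k c c' : T.Chain} (hk : T.IsDualLoop k) (h : T.Homologous c c') :
    T.pairing k c = T.pairing k c' := by
  obtain ⟨S, rfl⟩ := h
  rw [pairing_add_right, ← bdrySum_apply, pairing_bdrySum T hk, add_zero]

/-! ### Homology -/

theorem eq_of_bdrySum_eq_zero {S : T.Face → ZMod 2} (h : T.bdrySum S = 0) (f f' : T.Face) :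
    S f = S f' := by
  obtain ⟨d, rfl⟩ := T.faceOf_surjective f
  obtain ⟨d', rfl⟩ := T.faceOf_surjective f'
  have ho : ∀ d, S (T.faceOf (T.opp d)) = S (T.faceOf d) := fun d => by
    have := congrFun h (T.edgeOf d)
    rw [bdrySum_edgeOf] at this
    exact (CharTwo.add_eq_zero.1 this).symm
  exact T.eq_of_invariant (fun d => S (T.faceOf d))
    (fun d => by rw [← ho (T.rot d), faceOf_opp_rot]) ho d d'

theorem eq_of_starSum_eq_zero {S : T.Vertex → ZMod 2} (h : T.starSum S = 0) (v v' : T.Vertex) :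
    S v = S v' := by
  obtain ⟨d, rfl⟩ := T.vertexOf_surjective v
  obtain ⟨d', rfl⟩ := T.vertexOf_surjective v'
  have ho : ∀ d, S (T.vertexOf (T.opp d)) = S (T.vertexOf d) := fun d => by
    have := congrFun h (T.edgeOf d)
    rw [starSum_edgeOf] at this
    exact (CharTwo.add_eq_zero.1 this).symm
  exact T.eq_of_invariant (fun d => S (T.vertexOf d)) (fun d => by rw [vertexOf_rot]) ho d d'

theorem finrank_le_one_of_const {α : Type*} [Fintype α] [Nonempty α]
    (L : Submodule (ZMod 2) (α → ZMod 2)) (h : ∀ S ∈ L, ∀ a b, S a = S b) :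
    Module.finrank (ZMod 2) L ≤ 1 := by
  have hle : L ≤ Submodule.span (ZMod 2) {fun _ => 1} := fun S hS => by
    obtain ⟨a⟩ := ‹Nonempty α›
    refine Submodule.mem_span_singleton.2 ⟨S a, ?_⟩
    ext b
    simp [h S hS a b]
  refine (Submodule.finrank_mono hle).trans ?_
  simpa using finrank_span_le_card (R := ZMod 2) ({fun _ => 1} : Set (α → ZMod 2))

instance : Nonempty T.Face := T.nonempty.map T.faceOf
instance : Nonempty T.Vertex := T.nonempty.map T.vertexOf

theorem card_vertex_add_card_face :
    Fintype.card T.Vertex + Fintype.card T.Face = Fintype.card T.Edge := by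
  have h := T.euler
  rw [← Nat.card_eq_fintype_card, ← Nat.card_eq_fintype_card, ← Nat.card_eq_fintype_card]
  exact h

/-- The closed loops on the dual graph. -/
def dualLoops : Submodule (ZMod 2) T.Chain := LinearMap.ker (Matrix.mulVecLin (Matrix.of T.bdry))

theorem mem_dualLoops {c : T.Chain} : c ∈ T.dualLoops ↔ T.IsDualLoop c := by
  rw [dualLoops, LinearMap.mem_ker, funext_iff]
  rfl

/-- Dual loops are the kernel of the face-edge incidence matrix, whose transpose is `bdrySum`. Row
rank equals column rank and `bdrySum` has kernel of dimension at most one, so the bound is `E - (F -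
1) = V + 1`. -/
theorem finrank_dualLoops_le :
    Module.finrank (ZMod 2) T.dualLoops ≤ Fintype.card T.Vertex + 1 := by
  have h1 : _ + Module.finrank (ZMod 2) T.dualLoops = _ :=
    LinearMap.finrank_range_add_finrank_ker (Matrix.mulVecLin (Matrix.of T.bdry))
  have h2 := LinearMap.finrank_range_add_finrank_ker T.bdrySum
  have h3 := finrank_le_one_of_const (LinearMap.ker T.bdrySum)
    (fun S hS => T.eq_of_bdrySum_eq_zero hS)
  have h4 : Module.finrank (ZMod 2) (LinearMap.range (Matrix.mulVecLin (Matrix.of T.bdry))) =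
      Module.finrank (ZMod 2) (LinearMap.range T.bdrySum) := by
    change (Matrix.of T.bdry).rank = _
    rw [← Matrix.rank_transpose]
    have h : Matrix.mulVecLin (Matrix.of T.bdry).transpose = T.bdrySum := by
      refine LinearMap.ext fun S => funext fun e => ?_
      simp [bdrySum_apply, Matrix.vecMul, dotProduct, Finset.sum_apply]
    rw [Matrix.rank, h]
  have h5 := T.card_vertex_add_card_face
  rw [Module.finrank_fintype_fun_eq_card] at h1 h2
  omega

variable {T} in
/-- The dual loops are the stars and the sums of `x₁` and `x₂`, up to stars. -/
theorem LoopSystem.exists_eq_of_isDualLoop (W : T.LoopSystem) {k : T.Chain}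
    (hk : T.IsDualLoop k) :
    ∃ (S : T.Vertex → ZMod 2) (a b : ZMod 2), k = T.starSum S + (a • W.x₁ + b • W.x₂) := by
  let Θ : ((T.Vertex → ZMod 2) × (ZMod 2 × ZMod 2)) →ₗ[ZMod 2] T.Chain :=
    T.starSum.coprod ((LinearMap.toSpanSingleton _ _ W.x₁).coprod
      (LinearMap.toSpanSingleton _ _ W.x₂))
  have hΘ : ∀ p, Θ p = T.starSum p.1 + (p.2.1 • W.x₁ + p.2.2 • W.x₂) := fun p => rfl
  have hle : LinearMap.range Θ ≤ T.dualLoops := by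
    rintro _ ⟨p, rfl⟩
    rw [hΘ]
    refine add_mem (T.mem_dualLoops.2 (T.isDualLoop_starSum _)) (add_mem ?_ ?_)
    · exact Submodule.smul_mem _ _ (T.mem_dualLoops.2 W.loop_x₁)
    · exact Submodule.smul_mem _ _ (T.mem_dualLoops.2 W.loop_x₂)
  -- Crossing numbers with `z₁` and `z₂` read off the coefficients of `x₂` and `x₁`, so a relation
  -- involves stars only.
  have hker : ∀ p ∈ LinearMap.ker Θ, T.starSum p.1 = 0 ∧ p.2 = 0 := by
    intro p hp
    rw [LinearMap.mem_ker, hΘ] at hp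
    have h1 := congrArg (T.pairing W.z₁) hp
    have h2 := congrArg (T.pairing W.z₂) hp
    simp only [pairing_add_right, pairing_smul_right, pairing_starSum T W.loop_z₁,
      pairing_starSum T W.loop_z₂, T.pairing_comm W.z₁ W.x₁, T.pairing_comm W.z₁ W.x₂,
      T.pairing_comm W.z₂ W.x₁, T.pairing_comm W.z₂ W.x₂, W.cross₁₁, W.cross₂₂,
      W.cross₁₂, W.cross₂₁, mul_zero, mul_one, zero_add, add_zero] at h1 h2
    have h1' : p.2.2 = 0 := by rw [h1]; exact dotProduct_zero _
    have h2' : p.2.1 = 0 := by rw [h2]; exact dotProduct_zero _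
    rw [h1', h2', zero_smul, zero_smul, add_zero, add_zero] at hp
    exact ⟨hp, Prod.ext h2' h1'⟩
  have hker1 : Module.finrank (ZMod 2) (LinearMap.ker Θ) ≤ 1 := by
    have hinj : Function.Injective
        ((LinearMap.fst (ZMod 2) (T.Vertex → ZMod 2) (ZMod 2 × ZMod 2)).domRestrict
          (LinearMap.ker Θ)) := by
      rw [← LinearMap.ker_eq_bot, LinearMap.ker_eq_bot']
      rintro ⟨p, hp⟩ h
      exact Subtype.ext (Prod.ext h (hker p hp).2)
    rw [← LinearMap.finrank_range_of_inj hinj]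
    refine finrank_le_one_of_const _ ?_
    rintro _ ⟨⟨p, hp⟩, rfl⟩
    exact T.eq_of_starSum_eq_zero (hker p hp).1
  have h1 := LinearMap.finrank_range_add_finrank_ker Θ
  rw [Module.finrank_prod, Module.finrank_prod, Module.finrank_fintype_fun_eq_card,
    Module.finrank_self] at h1
  have h2 := T.finrank_dualLoops_le
  -- The range has dimension at least `V + 2 - 1`, which is the upper bound for the dual loops.
  have h3 : LinearMap.range Θ = T.dualLoops :=
    Submodule.eq_of_le_of_finrank_le hle (by omega)
  obtain ⟨p, hp⟩ : k ∈ LinearMap.range Θ := by rw [h3]; exact T.mem_dualLoops.2 hk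
  exact ⟨p.1, p.2.1, p.2.2, by rw [← hp, hΘ]⟩

/-! ### Pushing loops off the graph -/

theorem forall_mem_of_rot {P : D → Prop} (hP : ∀ d, P d → P (T.rot d)) {d d' : D}
    (h : T.vertexOf d = T.vertexOf d') (hd : P d) : P d' := by
  classical
  obtain ⟨n, -, -, rfl⟩ := (Quotient.exact h : T.rot.SameCycle d d').exists_pow_eq'
  induction n with
  | zero => exact hd
  | succ n ih =>
    rw [pow_succ', Equiv.Perm.mul_apply]
    refine hP _ (ih ?_)
    exact Quotient.sound ((Equiv.Perm.sameCycle_pow_right (f := T.rot)).2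
      (Equiv.Perm.SameCycle.refl _ _))

theorem exists_exit {P : D → Prop} {d d' : D} (h : T.vertexOf d = T.vertexOf d') (hd : P d)
    (hd' : ¬ P d') : ∃ x, T.vertexOf x = T.vertexOf d ∧ P x ∧ ¬ P (T.rot x) := by
  by_contra! hc
  refine hd' (T.forall_mem_of_rot (P := fun x => T.vertexOf x = T.vertexOf d ∧ P x) ?_ h
    ⟨rfl, hd⟩).2
  rintro x ⟨h1, h2⟩
  exact ⟨by rw [vertexOf_rot, h1], hc x h1 h2⟩

/-- If the boundary of `R` cuts at most two corners at `v`, the darts of `R` at `v` are contiguous: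
a function that agrees on neighbouring darts of `R` is constant on them. -/
theorem eq_of_simple_vertex {R : Finset T.Edge} {v : T.Vertex}
    (hv : Nat.card {d : D // T.vertexOf d = v ∧ T.IsCut R d} ≤ 2) {h : D → ZMod 2}
    (hh : ∀ d, T.edgeOf d ∈ R → T.edgeOf (T.rot d) ∈ R → h d = h (T.rot d)) {d d' : D}
    (hd : T.vertexOf d = v) (hd' : T.vertexOf d' = v) (hR : T.edgeOf d ∈ R)
    (hR' : T.edgeOf d' ∈ R) : h d = h d' := by
  classical
  by_contra hne
  -- The darts of `R` with value `h a` are left and re-entered when turning around `v`. Neighbours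
  -- in `R` agree, so both transitions are cut corners, the exit starting in `R` and the entry
  -- outside. Two distinct values would give two exits and an entry, three cut corners in all.
  have key : ∀ a b : D, T.vertexOf a = v → T.vertexOf b = v → T.edgeOf a ∈ R → T.edgeOf b ∈ R →
      h a ≠ h b → (∃ x, T.vertexOf x = v ∧ T.IsCut R x ∧ T.edgeOf x ∈ R ∧ h x = h a) ∧
        ∃ x, T.vertexOf x = v ∧ T.IsCut R x ∧ T.edgeOf x ∉ R := by
    intro a b ha hb hRa hRb hab
    have hvab : T.vertexOf a = T.vertexOf b := ha.trans hb.symm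
    obtain ⟨x, hx1, ⟨hx2, hx3⟩, hx4⟩ := T.exists_exit
      (P := fun x => T.edgeOf x ∈ R ∧ h x = h a) hvab ⟨hRa, rfl⟩ (fun hc => hab hc.2.symm)
    obtain ⟨y, hy1, hy2, hy3⟩ := T.exists_exit
      (P := fun x => ¬ (T.edgeOf x ∈ R ∧ h x = h a)) hvab.symm (fun hc => hab hc.2.symm)
      (fun hc => hc ⟨hRa, rfl⟩)
    rw [not_not] at hy3
    refine ⟨⟨x, hx1.trans ha, fun hc => hx4 ⟨hc.1 hx2, ?_⟩, hx2, hx3⟩,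
      y, hy1.trans hb, fun hc => hy2 ⟨hc.2 hy3.1, ?_⟩, fun hc => hy2 ⟨hc, ?_⟩⟩
    · rw [← hh x hx2 (hc.1 hx2), hx3]
    · rw [hh y (hc.2 hy3.1) hy3.1, hy3.2]
    · rw [hh y hc hy3.1, hy3.2]
  obtain ⟨⟨x, hx1, hx2, hx3, hx4⟩, y, hy1, hy2, hy3⟩ := key d d' hd hd' hR hR' hne
  obtain ⟨⟨w, hw1, hw2, hw3, hw4⟩, -⟩ := key d' d hd' hd hR' hR (Ne.symm hne)
  rw [Nat.card_eq_fintype_card, Fintype.card_subtype] at hv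
  have hsub : ({x, y, w} : Finset D) ⊆
      Finset.univ.filter fun d => T.vertexOf d = v ∧ T.IsCut R d := by
    intro u hu
    simp only [Finset.mem_insert, Finset.mem_singleton] at hu
    rw [Finset.mem_filter]
    rcases hu with rfl | rfl | rfl
    exacts [⟨Finset.mem_univ _, hx1, hx2⟩, ⟨Finset.mem_univ _, hy1, hy2⟩,
      ⟨Finset.mem_univ _, hw1, hw2⟩]
  have hxy : x ≠ y := fun hc => hy3 (hc ▸ hx3)
  have hyw : y ≠ w := fun hc => hy3 (hc ▸ hw3)
  have hxw : x ≠ w := fun hc => hne (by rw [← hx4, ← hw4, hc])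
  have := (Finset.card_le_card hsub).trans hv
  rw [Finset.card_eq_three.2 ⟨x, y, w, hxy, hxw, hyw, rfl⟩] at this
  omega

/-- A loop in `R` has two sides at each vertex, which can be told apart by a function on the corners
that vanishes at the corners touching the complement of `R`. -/
theorem exists_sides {R : Finset T.Edge}
    (hv : ∀ v, Nat.card {d : D // T.vertexOf d = v ∧ T.IsCut R d} ≤ 2) {c : T.Chain}
    (hc : T.IsLoop c) (hR : ∀ e, e ∉ R → c e = 0) :
    ∃ g : D → ZMod 2, (∀ d, g (T.rot d) + g d = c (T.edgeOf (T.rot d))) ∧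
      ∀ d, T.edgeOf d ∉ R ∨ T.edgeOf (T.rot d) ∉ R → g d = 0 := by
  classical
  let m : (D → ZMod 2) →ₗ[ZMod 2] (D → ZMod 2) := LinearMap.pi fun d =>
    if T.edgeOf d ∈ R ∧ T.edgeOf (T.rot d) ∈ R then LinearMap.proj d else 0
  have hm : ∀ g d, m g d = if T.edgeOf d ∈ R ∧ T.edgeOf (T.rot d) ∈ R then g d else 0 := by
    intro g d
    simp only [m, LinearMap.pi_apply]
    split_ifs <;> rfl
  let F : (D → ZMod 2) →ₗ[ZMod 2] (D → ZMod 2) := LinearMap.funLeft _ _ T.rot ∘ₗ m + m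
  have hF : ∀ g d, F g d = m g (T.rot d) + m g d := fun g d => rfl
  suffices hmem : (fun d => c (T.edgeOf (T.rot d))) ∈ LinearMap.range F by
    obtain ⟨g, hg⟩ := hmem
    refine ⟨m g, fun d => by rw [← hF, hg], fun d hd => ?_⟩
    rw [hm, if_neg]
    tauto
  -- Duality: otherwise some functional vanishes on the range of `F` but not on the right-hand side.
  -- Vanishing on the range makes it, after a turn, constant on the darts of `R` at each vertex, so
  -- its value on the right-hand side is a combination of the vertex conditions for `c`, hence zero.
  by_contra hmem
  obtain ⟨φ, hφ, hle⟩ := Submodule.exists_le_ker_of_notMem hmem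
  let h : D → ZMod 2 := fun d => φ (Pi.single d 1)
  have hφh : ∀ g, φ g = ∑ d, g d * h d := fun g => by
    rw [LinearMap.pi_apply_eq_sum_univ φ g]
    refine Finset.sum_congr rfl fun d _ => ?_
    rw [smul_eq_mul]
    congr 2
    ext x
    simp [Pi.single_apply, eq_comm]
  have hFh : ∀ g, ∑ d, F g d * h d = 0 := fun g => by
    rw [← hφh]; exact hle ⟨g, rfl⟩
  have hh : ∀ d, T.edgeOf d ∈ R → T.edgeOf (T.rot d) ∈ R → h d = h (T.rot⁻¹ d) := by
    intro d h1 h2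
    have h3 := hFh (Pi.single d 1)
    have hmd : m (Pi.single d 1) = Pi.single d 1 := by
      ext x
      rw [hm]
      rcases eq_or_ne x d with rfl | hx
      · rw [if_pos ⟨h1, h2⟩]
      · simp [hx]
    simp only [hF, hmd, add_mul, Finset.sum_add_distrib] at h3
    rw [← Equiv.sum_comp T.rot⁻¹] at h3
    simp only [Equiv.Perm.inv_def, Equiv.apply_symm_apply, Pi.single_apply, ite_mul, one_mul,
      zero_mul, Finset.sum_ite_eq', Finset.mem_univ, if_true] at h3
    exact (CharTwo.add_eq_zero.1 h3).symm
  refine hφ ?_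
  rw [hφh, ← Equiv.sum_comp T.rot⁻¹]
  simp only [Equiv.Perm.inv_def, Equiv.apply_symm_apply]
  rw [← Finset.sum_fiberwise Finset.univ T.vertexOf]
  refine Finset.sum_eq_zero fun v _ => ?_
  by_cases hex : ∃ d, T.vertexOf d = v ∧ T.edgeOf d ∈ R
  · obtain ⟨d₀, hd₀, hR₀⟩ := hex
    have h1 : ∀ d ∈ Finset.univ.filter (fun d => T.vertexOf d = v),
        c (T.edgeOf d) * h (T.rot.symm d) = c (T.edgeOf d) * h (T.rot.symm d₀) := by
      intro d hd
      by_cases hdR : T.edgeOf d ∈ R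
      · congr 1
        refine T.eq_of_simple_vertex (h := fun d => h (T.rot.symm d)) (hv v) ?_
          (Finset.mem_filter.1 hd).2 hd₀ hdR hR₀
        intro x hx hx'
        simp only [Equiv.symm_apply_apply]
        exact (hh x hx hx').symm
      · rw [hR _ hdR, zero_mul, zero_mul]
    rw [Finset.sum_congr rfl h1, ← Finset.sum_mul, Finset.sum_filter, ← pairing_legs, hc v,
      zero_mul]
  · push Not at hex
    refine Finset.sum_eq_zero fun d hd => ?_
    rw [hR _ (hex d (Finset.mem_filter.1 hd).2), zero_mul]

/-- A loop in `R` can be pushed to the dual graph within `R`, and the result is not a sum of stars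
unless the loop is a boundary. -/
theorem exists_push {R : Finset T.Edge}
    (hv : ∀ v, Nat.card {d : D // T.vertexOf d = v ∧ T.IsCut R d} ≤ 2) {c : T.Chain}
    (hc : T.IsLoop c) (hR : ∀ e, e ∉ R → c e = 0) :
    ∃ x : T.Chain, T.IsDualLoop x ∧ (∀ e, e ∉ R → x e = 0) ∧
      ∀ S, x = T.starSum S → ∃ S', c = T.bdrySum S' := by
  classical
  obtain ⟨g, hg, hg0⟩ := T.exists_sides hv hc hR
  have hg' : ∀ d, g d + g (T.rot.symm d) = c (T.edgeOf d) := fun d => by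
    have := hg (T.rot.symm d)
    rwa [Equiv.apply_symm_apply] at this
  have hopp : ∀ d, g (T.opp d) + g (T.rot.symm d) = g d + g (T.rot.symm (T.opp d)) := fun d => by
    have h1 := hg' d
    rw [← edgeOf_opp, ← hg' (T.opp d)] at h1
    grind
  -- The corners `d` and `rot.symm (opp d)` lie in the face left of `d`, at the two ends of its
  -- edge; the pushed loop crosses the edge iff they are on different sides of `c`. By `hopp` the
  -- face on the other side gives the same answer.
  obtain ⟨x, hx⟩ : ∃ x : T.Chain, ∀ d, x (T.edgeOf d) = g d + g (T.rot.symm (T.opp d)) := by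
    refine ⟨fun e => Quotient.liftOn e (fun d => g d + g (T.rot.symm (T.opp d))) ?_, fun d => rfl⟩
    intro a b hab
    rcases T.edgeOf_eq_iff.1 (Quotient.sound hab : T.edgeOf a = T.edgeOf b) with rfl | rfl
    · rfl
    · simp only [T.opp_opp]
      exact hopp b
  refine ⟨x, fun f => ?_, fun e he => ?_, fun S hS => ?_⟩
  -- Each corner of the face is counted twice, once for each of its two edges.
  · rw [pairing_bdry]
    simp only [hx]
    rw [← Finset.sum_filter, Finset.sum_add_distrib, CharTwo.add_eq_zero, Finset.sum_filter,
      Finset.sum_filter, ← Equiv.sum_comp (T.rot⁻¹ * T.opp)]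
    refine Finset.sum_congr rfl fun d _ => ?_
    rw [Equiv.Perm.mul_apply, faceOf_next]
    rfl
  · obtain ⟨d, rfl⟩ := T.edgeOf_surjective e
    rw [hx, hg0 d (Or.inl he), hg0 _ (Or.inr _), add_zero]
    rwa [Equiv.apply_symm_apply, edgeOf_opp]
  -- If `x` is a sum of stars, correcting the side function by `S` makes it constant around each
  -- face; the resulting set of faces has boundary `c`.
  · have hnext : ∀ d, g (T.rot.symm (T.opp d)) + S (T.vertexOf (T.rot.symm (T.opp d))) =
        g d + S (T.vertexOf d) := fun d => by
      have h1 := hx d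
      have h2 : T.vertexOf (T.rot.symm (T.opp d)) = T.vertexOf (T.opp d) := by
        conv_rhs => rw [← T.rot.apply_symm_apply (T.opp d), vertexOf_rot]
      rw [hS, starSum_edgeOf] at h1
      rw [h2]
      grind
    refine ⟨fun f => Quotient.liftOn f (fun d => g d + S (T.vertexOf d)) ?_, ?_⟩
    · intro a b hab
      obtain ⟨n, -, -, rfl⟩ := Equiv.Perm.SameCycle.exists_pow_eq' hab
      clear hab
      induction n with
      | zero => rfl
      | succ n ih =>
        rw [pow_succ', Equiv.Perm.mul_apply]
        exact ih.trans (hnext _).symm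
    · ext e
      obtain ⟨d, rfl⟩ := T.edgeOf_surjective e
      rw [bdrySum_edgeOf]
      have h3 : T.faceOf (T.opp d) = T.faceOf (T.rot.symm d) := by
        rw [← faceOf_next, T.opp_opp]; rfl
      rw [h3]
      change c _ = (g d + S (T.vertexOf d)) +
        (g (T.rot.symm d) + S (T.vertexOf (T.rot.symm d)))
      have h4 : T.vertexOf (T.rot.symm d) = T.vertexOf d := by
        conv_rhs => rw [← T.rot.apply_symm_apply d, vertexOf_rot]
      rw [h4, ← hg']
      grind

end TorusLattice

namespace TorusLattice

variable {D : Type*} [Fintype D] {T : TorusLattice D}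

/-! ### The group of dual loops of trivial flux -/

/-- The dual loops that cross `z₁` an even number of times. -/
def LoopSystem.fluxGroup (W : T.LoopSystem) : Submodule (ZMod 2) T.Chain :=
  T.dualLoops ⊓ LinearMap.ker (T.pairingHom W.z₁)

theorem LoopSystem.mem_fluxGroup (W : T.LoopSystem) {k : T.Chain} :
    k ∈ W.fluxGroup ↔ T.IsDualLoop k ∧ T.pairing W.z₁ k = 0 := by
  rw [fluxGroup, Submodule.mem_inf, mem_dualLoops, LinearMap.mem_ker, pairingHom_apply]

theorem LoopSystem.legs_mem_fluxGroup (W : T.LoopSystem) (v : T.Vertex) :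
    T.legs v ∈ W.fluxGroup :=
  W.mem_fluxGroup.2 ⟨fun f => T.pairing_bdry_legs f v, by rw [pairing_comm, W.loop_z₁ v]⟩

theorem LoopSystem.x₁_mem_fluxGroup (W : T.LoopSystem) : W.x₁ ∈ W.fluxGroup :=
  W.mem_fluxGroup.2 ⟨W.loop_x₁, by rw [pairing_comm, W.cross₁₁]⟩

theorem LoopSystem.exists_eq_of_mem_fluxGroup (W : T.LoopSystem) {k : T.Chain}
    (hk : k ∈ W.fluxGroup) : ∃ (S : T.Vertex → ZMod 2) (a : ZMod 2),
      k = T.starSum S + a • W.x₁ := by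
  obtain ⟨hk, hz⟩ := W.mem_fluxGroup.1 hk
  obtain ⟨S, a, b, rfl⟩ := W.exists_eq_of_isDualLoop hk
  rw [pairing_add_right, pairing_add_right, pairing_starSum T W.loop_z₁, pairing_smul_right,
    pairing_smul_right, pairing_comm T W.z₁ W.x₁, pairing_comm T W.z₁ W.x₂, W.cross₁₁, W.cross₂₁,
    mul_zero, zero_add, zero_add, mul_one] at hz
  exact ⟨S, a, by rw [hz, zero_smul, add_zero]⟩

theorem pairing_eq_zero_of_disjoint {R : Finset T.Edge} {a b : T.Chain}
    (ha : ∀ e, e ∉ R → a e = 0) (hb : ∀ e, e ∉ Rᶜ → b e = 0) : T.pairing a b = 0 :=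
  Finset.sum_eq_zero fun e _ => by
    by_cases he : e ∈ R
    · rw [hb e (by simpa using he), mul_zero]
    · rw [ha e he, zero_mul]

/-- The crossing number with `z₁` may be computed on the homologous loop in the complement, which
`k` does not meet. -/
theorem LoopSystem.mem_fluxGroup_of_winds (W : T.LoopSystem) {R : Finset T.Edge}
    (hR : T.WindsAlong W.z₁ Rᶜ) {k : T.Chain} (hk : T.IsDualLoop k) (hkR : ∀ e, e ∉ R → k e = 0) :
    k ∈ W.fluxGroup := by
  obtain ⟨c, -, hcR, hc⟩ := hR
  refine W.mem_fluxGroup.2 ⟨hk, ?_⟩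
  rw [pairing_comm, ← T.pairing_of_homologous hk hc]
  exact pairing_eq_zero_of_disjoint hkR hcR

/-- A non-contractible region contains a dual loop in the class of `x₁`. -/
theorem LoopSystem.exists_dualLoop_of_winds (W : T.LoopSystem) {R : Finset T.Edge}
    (hv : ∀ v, Nat.card {d : D // T.vertexOf d = v ∧ T.IsCut R d} ≤ 2)
    (hR : T.WindsAlong W.z₁ R) (hR' : T.WindsAlong W.z₁ Rᶜ) :
    ∃ x ∈ W.fluxGroup, (∀ e, e ∉ R → x e = 0) ∧ ∃ S, x = T.starSum S + W.x₁ := by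
  obtain ⟨c, hc, hcR, hcz⟩ := hR
  obtain ⟨x, hx, hxR, hxc⟩ := T.exists_push hv hc hcR
  have hxK := W.mem_fluxGroup_of_winds hR' hx hxR
  refine ⟨x, hxK, hxR, ?_⟩
  obtain ⟨S, a, ha⟩ := W.exists_eq_of_mem_fluxGroup hxK
  rcases ZMod.two_cases a with rfl | rfl
  -- Without `x₁` the loop `c` would be a boundary and cross `x₂` evenly, whereas its class `z₁`
  -- crosses `x₂` oddly.
  · rw [zero_smul, add_zero] at ha
    obtain ⟨S', rfl⟩ := hxc S ha
    have h := T.pairing_of_homologous W.loop_x₂ hcz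
    rw [T.pairing_bdrySum W.loop_x₂, W.cross₂₁] at h
    exact absurd h zero_ne_one
  · exact ⟨S, by rw [ha, one_smul]⟩

theorem LoopSystem.pairing_z₂_eq_one (W : T.LoopSystem) (S : T.Vertex → ZMod 2) :
    T.pairing W.z₂ (T.starSum S + W.x₁) = 1 := by
  rw [pairing_add_right, pairing_starSum T W.loop_z₂, pairing_comm, W.cross₁₂, zero_add]

/-! ### The violation of the plaquettes by a restricted dual loop -/

/-- The faces whose boundary is crossed an odd number of times within the region `A`. -/
def cutMap (A : Finset T.Edge) : T.Chain →ₗ[ZMod 2] (T.Face → ZMod 2) :=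
  Matrix.mulVecLin (Matrix.of T.bdry) ∘ₗ T.mask A

theorem cutMap_apply (A : Finset T.Edge) (k : T.Chain) (f : T.Face) :
    cutMap A k f = T.pairing (T.bdry f) (T.mask A k) := rfl

theorem cutMap_eq_zero {A : Finset T.Edge} {k : T.Chain} :
    cutMap A k = 0 ↔ T.IsDualLoop (T.mask A k) := by
  rw [funext_iff]; rfl

theorem LoopSystem.cutMap_eq_zero_iff (W : T.LoopSystem) {A : Finset T.Edge}
    (hA : T.WindsAlong W.z₁ Aᶜ) {k : T.Chain} : cutMap A k = 0 ↔ T.mask A k ∈ W.fluxGroup := by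
  rw [cutMap_eq_zero]
  refine ⟨fun h => W.mem_fluxGroup_of_winds hA h fun e he => ?_, fun h => (W.mem_fluxGroup.1 h).1⟩
  rw [mask_apply, if_neg he]

/-- Every edge has a face on each of its two sides, so the face boundaries sum to zero. -/
theorem sum_cutMap (A : Finset T.Edge) (k : T.Chain) : ∑ f, cutMap A k f = 0 := by
  have h : T.bdrySum 1 = 0 := by
    ext e
    obtain ⟨d, rfl⟩ := T.edgeOf_surjective e
    rw [bdrySum_edgeOf]
    exact CharTwo.add_self_eq_zero _
  have h2 := T.pairing_sum_smul_right (T.mask A k) 1 T.bdry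
  rw [← bdrySum_apply, h] at h2
  simp only [cutMap_apply, T.pairing_comm (T.bdry _)]
  simp only [Pi.one_apply, one_mul] at h2
  rw [← h2]
  exact dotProduct_zero _

/-! ### The image of the flux group under the cut map -/

theorem connectedComponentMk_vertexOf {A : Finset T.Edge} {d : D} (hd : T.IsCut A d) :
    (T.boundaryGraph A).connectedComponentMk (Sum.inl (T.vertexOf d)) =
      T.boundaryAt A (T.faceOf d) := by
  refine SimpleGraph.ConnectedComponent.sound (SimpleGraph.Adj.reachable ?_)
  rw [boundaryGraph, SimpleGraph.fromRel_adj]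
  exact ⟨Sum.inl_ne_inr, Or.inl ⟨d, hd, rfl, rfl⟩⟩

theorem exists_cut_of_cutMap_legs_ne {A : Finset T.Edge} {v : T.Vertex} {f : T.Face}
    (h : cutMap A (T.legs v) f ≠ 0) : ∃ d, T.IsCut A d ∧ T.vertexOf d = v ∧ T.faceOf d = f := by
  by_contra! hc
  refine h ?_
  rw [cutMap_apply, pairing_bdry_mask_legs]
  have : IsEmpty {d : D // T.vertexOf d = v ∧ T.faceOf d = f ∧ T.IsCut A d} :=
    ⟨fun x => hc x.1 x.2.2.2 x.2.1 x.2.2.1⟩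
  simp

-- The cut corners at `v` all lie on the component through `v`. Hence the sum over `Γ` is either the
-- full sum, zero by `sum_cutMap`, or has only zero terms.
open Classical in
theorem sum_cutMap_legs (A : Finset T.Edge) (v : T.Vertex)
    (Γ : (T.boundaryGraph A).ConnectedComponent) :
    ∑ f ∈ Finset.univ.filter (fun f => T.boundaryAt A f = Γ), cutMap A (T.legs v) f = 0 := by
  have hcomp : ∀ f, cutMap A (T.legs v) f ≠ 0 →
      (T.boundaryGraph A).connectedComponentMk (Sum.inl v) = T.boundaryAt A f := by
    intro f hf
    obtain ⟨d, hd, rfl, rfl⟩ := exists_cut_of_cutMap_legs_ne hf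
    exact connectedComponentMk_vertexOf hd
  by_cases hv : (T.boundaryGraph A).connectedComponentMk (Sum.inl v) = Γ
  · rw [← sum_cutMap A (T.legs v)]
    refine Finset.sum_subset (Finset.subset_univ _) fun f _ hf => ?_
    by_contra hne
    exact hf (Finset.mem_filter.2 ⟨Finset.mem_univ _, (hcomp f hne).symm.trans hv⟩)
  · refine Finset.sum_eq_zero fun f hf => ?_
    by_contra hne
    exact hv ((hcomp f hne).trans (Finset.mem_filter.1 hf).2)

open Classical in
theorem cutMap_legs_of_ne {A : Finset T.Edge} {d d' : D}
    (hv : Nat.card {x : D // T.vertexOf x = T.vertexOf d ∧ T.IsCut A x} ≤ 2)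
    (hd : T.IsCut A d) (hd' : T.IsCut A d') (hvd : T.vertexOf d' = T.vertexOf d) (hne : d ≠ d') :
    cutMap A (T.legs (T.vertexOf d)) =
      Pi.single (T.faceOf d) 1 + Pi.single (T.faceOf d') 1 := by
  have hset : ({d, d'} : Finset D) =
      Finset.univ.filter fun x => T.vertexOf x = T.vertexOf d ∧ T.IsCut A x := by
    refine Finset.eq_of_subset_of_card_le (fun x hx => ?_) ?_
    · rw [Finset.mem_filter]
      simp only [Finset.mem_insert, Finset.mem_singleton] at hx
      rcases hx with rfl | rfl
      exacts [⟨Finset.mem_univ _, rfl, hd⟩, ⟨Finset.mem_univ _, hvd, hd'⟩]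
    · rw [Finset.card_pair hne]
      rwa [Nat.card_eq_fintype_card, Fintype.card_subtype] at hv
  ext f
  rw [cutMap_apply, pairing_bdry_mask_legs, Nat.card_eq_fintype_card, Fintype.card_subtype]
  have : (Finset.univ.filter fun x => T.vertexOf x = T.vertexOf d ∧ T.faceOf x = f ∧ T.IsCut A x) =
      ({d, d'} : Finset D).filter fun x => T.faceOf x = f := by
    rw [hset, Finset.filter_filter]
    exact Finset.filter_congr fun x _ => by tauto
  rw [this, ← Finset.sum_boole, Finset.sum_pair hne, Pi.add_apply, Pi.single_apply,
    Pi.single_apply]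
  simp only [eq_comm]

/-- Consecutive faces along the boundary are joined by a star whose cut is their sum, and these sums
telescope. -/
theorem single_add_single_mem {A : Finset T.Edge} {L : Submodule (ZMod 2) (T.Face → ZMod 2)}
    (hv : ∀ v, Nat.card {x : D // T.vertexOf x = v ∧ T.IsCut A x} ≤ 2)
    (hL : ∀ v, cutMap A (T.legs v) ∈ L) {f f' : T.Face}
    (h : T.boundaryAt A f = T.boundaryAt A f') :
    (Pi.single f 1 + Pi.single f' 1 : T.Face → ZMod 2) ∈ L := by
  classical
  have htrans : ∀ a b c : T.Face → ZMod 2, a + b ∈ L → b + c ∈ L → a + c ∈ L := by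
    intro a b c h1 h2
    have := L.add_mem h1 h2
    rwa [add_assoc, ← add_assoc b, add_self_of_zmod_two, zero_add] at this
  have hcut : ∀ d d', T.IsCut A d → T.IsCut A d' → T.vertexOf d' = T.vertexOf d →
      (Pi.single (T.faceOf d) 1 + Pi.single (T.faceOf d') 1 : T.Face → ZMod 2) ∈ L := by
    intro d d' hd hd' hvd
    rcases eq_or_ne d d' with rfl | hne
    · rw [add_self_of_zmod_two]; exact L.zero_mem
    · rw [← cutMap_legs_of_ne (hv _) hd hd' hvd hne]; exact hL _
  have hreach := SimpleGraph.ConnectedComponent.exact h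
  rw [SimpleGraph.reachable_iff_reflTransGen] at hreach
  -- At a star the invariant covers every cut corner, since the walk may leave through any of them.
  suffices hmain : ∀ w, Relation.ReflTransGen (T.boundaryGraph A).Adj (Sum.inr f) w →
      (∀ f', w = Sum.inr f' → (Pi.single f 1 + Pi.single f' 1 : T.Face → ZMod 2) ∈ L) ∧
      ∀ d, T.IsCut A d → w = Sum.inl (T.vertexOf d) →
        (Pi.single f 1 + Pi.single (T.faceOf d) 1 : T.Face → ZMod 2) ∈ L from
    (hmain _ hreach).1 f' rfl
  intro w hw
  induction hw with
  | refl =>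
    refine ⟨fun f' hf' => ?_, fun d _ hd => by simp at hd⟩
    rw [Sum.inr.inj hf', add_self_of_zmod_two]
    exact L.zero_mem
  | tail _ hadj ih =>
    rw [boundaryGraph, SimpleGraph.fromRel_adj] at hadj
    rcases hadj with ⟨-, ⟨d, hd, rfl, rfl⟩ | ⟨d, hd, rfl, rfl⟩⟩
    · refine ⟨fun f' hf' => ?_, fun d _ hd => by simp at hd⟩
      rw [← Sum.inr.inj hf']
      exact ih.2 d hd rfl
    · refine ⟨fun f' hf' => by simp at hf', fun d' hd' hv' => ?_⟩
      exact htrans _ _ _ (ih.1 _ rfl) (hcut d d' hd hd' (Sum.inl.inj hv').symm)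

/-- Modulo stars `x₁` is a dual loop inside `A`, which `cutMap A` kills; so stars alone generate the
image. -/
theorem LoopSystem.map_cutMap_le (W : T.LoopSystem) {A : Finset T.Edge}
    (hv : ∀ v, Nat.card {d : D // T.vertexOf d = v ∧ T.IsCut A d} ≤ 2)
    (hA : T.WindsAlong W.z₁ A) (hA' : T.WindsAlong W.z₁ Aᶜ)
    {L : Submodule (ZMod 2) (T.Face → ZMod 2)} (hL : ∀ v, cutMap A (T.legs v) ∈ L) :
    W.fluxGroup.map (cutMap A) ≤ L := by
  obtain ⟨x, hx, hxA, S', hS'⟩ := W.exists_dualLoop_of_winds hv hA hA'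
  have hx0 : cutMap A x = 0 := by
    rw [cutMap_eq_zero, T.mask_eq_self hxA]
    exact (W.mem_fluxGroup.1 hx).1
  have hstar : ∀ S, cutMap A (T.starSum S) ∈ L := fun S => by
    rw [starSum_apply, map_sum]
    refine L.sum_mem fun v _ => ?_
    rw [map_smul]
    exact L.smul_mem _ (hL v)
  have hx₁ : cutMap A W.x₁ ∈ L := by
    have h := hx0
    rw [hS', map_add] at h
    rw [← (eq_neg_of_add_eq_zero_right h).symm]
    exact L.neg_mem (hstar S')
  rintro _ ⟨k, hk, rfl⟩
  obtain ⟨S, a, rfl⟩ := W.exists_eq_of_mem_fluxGroup hk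
  rw [map_add, map_smul]
  exact L.add_mem (hstar S) (L.smul_mem a hx₁)

open Classical in
/-- The sets of faces on the boundary components `Γ₁` and `Γ₂` of even size on both. -/
def evenOn {A : Finset T.Edge} (Γ₁ Γ₂ : (T.boundaryGraph A).ConnectedComponent) :
    Submodule (ZMod 2) (T.Face → ZMod 2) where
  carrier := {S | (∀ f, T.boundaryAt A f ≠ Γ₁ → T.boundaryAt A f ≠ Γ₂ → S f = 0) ∧
    (∑ f ∈ Finset.univ.filter (fun f => T.boundaryAt A f = Γ₁), S f = 0) ∧
    (∑ f ∈ Finset.univ.filter (fun f => T.boundaryAt A f = Γ₂), S f = 0)}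
  zero_mem' := by simp
  add_mem' := by
    rintro a b ⟨ha, ha1, ha2⟩ ⟨hb, hb1, hb2⟩
    refine ⟨fun f h1 h2 => ?_, ?_, ?_⟩
    · rw [Pi.add_apply, ha f h1 h2, hb f h1 h2, add_zero]
    · simp only [Pi.add_apply, Finset.sum_add_distrib, ha1, hb1, add_zero]
    · simp only [Pi.add_apply, Finset.sum_add_distrib, ha2, hb2, add_zero]
  smul_mem' := by
    rintro c a ⟨ha, ha1, ha2⟩
    refine ⟨fun f h1 h2 => ?_, ?_, ?_⟩
    · rw [Pi.smul_apply, ha f h1 h2, smul_zero]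
    · simp only [Pi.smul_apply, ← Finset.smul_sum, ha1, smul_zero]
    · simp only [Pi.smul_apply, ← Finset.smul_sum, ha2, smul_zero]

/-- An even set on a component is fixed by its values off one base face, which explains the `- 1`.
These values are free, because the image contains every pair formed by a face and its base face. -/
theorem LoopSystem.card_map_cutMap (W : T.LoopSystem) {A : Finset T.Edge}
    {Γ₁ Γ₂ : (T.boundaryGraph A).ConnectedComponent}
    (hA : T.IsAnnularBipartition W.z₁ A Γ₁ Γ₂) :
    Nat.card (W.fluxGroup.map (cutMap A)) =
      2 ^ (T.numPlaquettes A Γ₁ - 1) * 2 ^ (T.numPlaquettes A Γ₂ - 1) := by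
  classical
  set L := W.fluxGroup.map (cutMap A) with hL
  have hlegs : ∀ v, cutMap A (T.legs v) ∈ L := fun v => ⟨_, W.legs_mem_fluxGroup v, rfl⟩
  have hle : L ≤ evenOn Γ₁ Γ₂ := by
    refine W.map_cutMap_le hA.simple_vertex hA.winds_left hA.winds_right fun v =>
      ⟨fun f h1 h2 => ?_, sum_cutMap_legs A v Γ₁, sum_cutMap_legs A v Γ₂⟩
    by_contra hne
    obtain ⟨d, hd, -, rfl⟩ := exists_cut_of_cutMap_legs_ne hne
    have : T.boundaryAt A (T.faceOf d) ∈ ({Γ₁, Γ₂} : Set _) := by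
      rw [← hA.two]; exact ⟨d, hd, rfl⟩
    rcases this with h | h
    exacts [h1 h, h2 h]
  have hex : ∀ Γ ∈ ({Γ₁, Γ₂} : Set _), ∃ f, T.boundaryAt A f = Γ := by
    intro Γ hΓ
    rw [← hA.two] at hΓ
    obtain ⟨d, -, hd⟩ := hΓ
    exact ⟨_, hd⟩
  obtain ⟨f₁, hf₁⟩ := hex Γ₁ (Or.inl rfl)
  obtain ⟨f₂, hf₂⟩ := hex Γ₂ (Or.inr rfl)
  let s₁ := (Finset.univ.filter fun f => T.boundaryAt A f = Γ₁).erase f₁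
  let s₂ := (Finset.univ.filter fun f => T.boundaryAt A f = Γ₂).erase f₂
  have hs : ∀ f, f ∈ s₁ ↔ f ≠ f₁ ∧ T.boundaryAt A f = Γ₁ := fun f => by simp [s₁]
  have hs' : ∀ f, f ∈ s₂ ↔ f ≠ f₂ ∧ T.boundaryAt A f = Γ₂ := fun f => by simp [s₂]
  have hc₁ : s₁.card = T.numPlaquettes A Γ₁ - 1 := by
    rw [numPlaquettes, Nat.card_eq_fintype_card, Fintype.card_subtype]
    exact Finset.card_erase_of_mem (by simpa using hf₁)
  have hc₂ : s₂.card = T.numPlaquettes A Γ₂ - 1 := by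
    rw [numPlaquettes, Nat.card_eq_fintype_card, Fintype.card_subtype]
    exact Finset.card_erase_of_mem (by simpa using hf₂)
  let ρ : L → (s₁ → ZMod 2) × (s₂ → ZMod 2) := fun S => (fun f => S.1 f, fun f => S.1 f)
  have hρ : Function.Bijective ρ := by
    constructor
    · intro S S' h
      have hd : (S.1 + S'.1) ∈ evenOn Γ₁ Γ₂ := add_mem (hle S.2) (hle S'.2)
      have h1 : ∀ f ∈ s₁, (S.1 + S'.1) f = 0 := fun f hf => by
        have : S.1 f = S'.1 f := congrFun (congrArg Prod.fst h) ⟨f, hf⟩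
        rw [Pi.add_apply, this, CharTwo.add_self_eq_zero]
      have h2 : ∀ f ∈ s₂, (S.1 + S'.1) f = 0 := fun f hf => by
        have : S.1 f = S'.1 f := congrFun (congrArg Prod.snd h) ⟨f, hf⟩
        rw [Pi.add_apply, this, CharTwo.add_self_eq_zero]
      obtain ⟨hd0, hd1, hd2⟩ := hd
      rw [← Finset.add_sum_erase _ _ (show f₁ ∈ _ by simpa using hf₁), Finset.sum_eq_zero h1,
        add_zero] at hd1
      rw [← Finset.add_sum_erase _ _ (show f₂ ∈ _ by simpa using hf₂), Finset.sum_eq_zero h2,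
        add_zero] at hd2
      refine Subtype.ext (funext fun f => ?_)
      have hz : (S.1 + S'.1) f = 0 := by
        by_cases hΓ₁ : T.boundaryAt A f = Γ₁
        · rcases eq_or_ne f f₁ with rfl | hne
          exacts [hd1, h1 f ((hs f).2 ⟨hne, hΓ₁⟩)]
        · by_cases hΓ₂ : T.boundaryAt A f = Γ₂
          · rcases eq_or_ne f f₂ with rfl | hne
            exacts [hd2, h2 f ((hs' f).2 ⟨hne, hΓ₂⟩)]
          · exact hd0 f hΓ₁ hΓ₂
      exact CharTwo.add_eq_zero.1 hz
    · rintro ⟨p, q⟩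
      have hmem : (∑ f : s₁, p f • (Pi.single f.1 1 + Pi.single f₁ 1) +
          ∑ f : s₂, q f • (Pi.single f.1 1 + Pi.single f₂ 1) : T.Face → ZMod 2) ∈ L := by
        refine add_mem (sum_mem fun f _ => L.smul_mem _ ?_) (sum_mem fun f _ => L.smul_mem _ ?_)
        · exact single_add_single_mem hA.simple_vertex hlegs
            (((hs f).1 f.2).2.trans hf₁.symm)
        · exact single_add_single_mem hA.simple_vertex hlegs
            (((hs' f).1 f.2).2.trans hf₂.symm)
      refine ⟨⟨_, hmem⟩, Prod.ext (funext fun g => ?_) (funext fun g => ?_)⟩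
      · have h1 : g.1 ≠ f₁ := ((hs g).1 g.2).1
        have h2 : g.1 ≠ f₂ := fun h => hA.ne (((hs g).1 g.2).2.symm.trans (h ▸ hf₂))
        have h3 : ∀ f : s₂, g.1 ≠ f.1 := fun f h =>
          hA.ne (((hs g).1 g.2).2.symm.trans (h ▸ ((hs' f).1 f.2).2))
        simp [ρ, Finset.sum_apply, Pi.single_apply, h1, h2, h3]
      · have h1 : g.1 ≠ f₂ := ((hs' g).1 g.2).1
        have h2 : g.1 ≠ f₁ := fun h => hA.ne.symm (((hs' g).1 g.2).2.symm.trans (h ▸ hf₁))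
        have h3 : ∀ f : s₁, g.1 ≠ f.1 := fun f h =>
          hA.ne.symm (((hs' g).1 g.2).2.symm.trans (h ▸ ((hs f).1 f.2).2))
        simp [ρ, Finset.sum_apply, Pi.single_apply, h1, h2, h3]
  rw [Nat.card_eq_of_bijective ρ hρ, Nat.card_prod, Nat.card_eq_fintype_card,
    Nat.card_eq_fintype_card, Fintype.card_fun, Fintype.card_fun, ZMod.card, Fintype.card_coe,
    Fintype.card_coe, hc₁, hc₂]

end TorusLattice

/-- Whether the flux contains `e`, which is detected by `W^z₁`. -/
def Flux.charge : Flux → ZMod 2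
  | .one => 0
  | .e => 1
  | .m => 0
  | .em => 1

/-- Whether the flux contains `m`, which is detected by `W^x₁`. -/
def Flux.vortex : Flux → ZMod 2
  | .one => 0
  | .e => 0
  | .m => 1
  | .em => 1

theorem Flux.ext_of_charge_vortex {i j : Flux} (h : i.charge = j.charge)
    (h' : i.vortex = j.vortex) : i = j := by
  cases i <;> cases j <;> first | rfl | simp [charge, vortex] at h h'

namespace TorusLattice

variable {D : Type*} [Fintype D] {T : TorusLattice D}

/-! ### Restriction to a region and extension by zero -/

/-- The restriction of a chain to a region. -/
def res (R : Finset T.Edge) : T.Chain →ₗ[ZMod 2] ({e : T.Edge // e ∈ R} → ZMod 2) :=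
  LinearMap.funLeft _ _ Subtype.val

/-- The extension of a chain in a region by zero. -/
def ext (R : Finset T.Edge) : ({e : T.Edge // e ∈ R} → ZMod 2) →ₗ[ZMod 2] T.Chain where
  toFun a e := if h : e ∈ R then a ⟨e, h⟩ else 0
  map_add' a b := by ext e; by_cases h : e ∈ R <;> simp [h]
  map_smul' a b := by ext e; by_cases h : e ∈ R <;> simp [h]

theorem ext_apply (R : Finset T.Edge) (a : {e : T.Edge // e ∈ R} → ZMod 2) (e : T.Edge) :
    ext R a e = if h : e ∈ R then a ⟨e, h⟩ else 0 := rfl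

theorem ext_res (R : Finset T.Edge) (s : T.Chain) : ext R (res R s) = T.mask R s := by
  ext e
  by_cases h : e ∈ R <;> simp [ext_apply, res, mask_apply, h]

theorem res_ext (R : Finset T.Edge) (a : {e : T.Edge // e ∈ R} → ZMod 2) :
    res R (ext R a) = a := by
  ext e
  simp [ext_apply, res]

theorem ext_injective (R : Finset T.Edge) : Function.Injective (ext (T := T) R) :=
  Function.LeftInverse.injective (res_ext R)

theorem ext_eq_zero (R : Finset T.Edge) (a : {e : T.Edge // e ∈ R} → ZMod 2) (e : T.Edge)
    (he : e ∉ R) : ext R a e = 0 := by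
  rw [ext_apply, dif_neg he]

/-- The restrictions to `R` of the elements of the flux group supported on `R`. -/
def LoopSystem.regionGroup (W : T.LoopSystem) (R : Finset T.Edge) :
    Submodule (ZMod 2) ({e : T.Edge // e ∈ R} → ZMod 2) := W.fluxGroup.comap (ext R)

/-- The Schmidt vector in the region `R` of flux `i` for the coset represented by `u`. -/
def LoopSystem.regionVec (W : T.LoopSystem) (R : Finset T.Edge) (i : Flux) (u : T.Chain) :
    T.RegionHilb R :=
  cosetVec (W.regionGroup R) (i.vortex • (T.pairingHom W.z₂ ∘ₗ ext R))
    (res R (u + i.charge • W.x₂))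

theorem LoopSystem.inner_regionVec (W : T.LoopSystem) {R : Finset T.Edge}
    (hv : ∀ v, Nat.card {d : D // T.vertexOf d = v ∧ T.IsCut R d} ≤ 2)
    (hR : T.WindsAlong W.z₁ R) (hR' : T.WindsAlong W.z₁ Rᶜ) {ι : Type*} [DecidableEq ι]
    {u : ι → T.Chain} (hu : ∀ p, u p ∈ W.fluxGroup)
    (hsep : ∀ p q, T.mask R (u p + u q) ∈ W.fluxGroup → p = q) (i i' : Flux) (p p' : ι) :
    inner ℂ (W.regionVec R i' (u p')) (W.regionVec R i (u p)) =
      if p = p' ∧ i = i' then 1 else 0 := by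
  by_cases h : p = p' ∧ i = i'
  · obtain ⟨rfl, rfl⟩ := h
    rw [if_pos ⟨rfl, rfl⟩]
    exact inner_cosetVec_self _ _ _
  rw [if_neg h]
  obtain ⟨x, hx, hxR, S, hxS⟩ := W.exists_dualLoop_of_winds hv hR hR'
  -- Different vortex: the signs differ by the crossing number with `z₂`, which is odd on the dual
  -- loop `x` inside `R`.
  by_cases hm : i.vortex = i'.vortex
  swap
  · refine inner_cosetVec_of_ne (y := res R x) ?_ ?_
    · rw [regionGroup, Submodule.mem_comap, ext_res, T.mask_eq_self hxR]
      exact hx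
    · have hz : T.pairing W.z₂ x = 1 := by rw [hxS, W.pairing_z₂_eq_one]
      rw [LinearMap.add_apply, LinearMap.smul_apply, LinearMap.smul_apply, LinearMap.comp_apply,
        ext_res, T.mask_eq_self hxR, pairingHom_apply, hz]
      rcases ZMod.two_cases i.vortex with h1 | h1 <;> rcases ZMod.two_cases i'.vortex with h2 | h2
      · exact absurd (h1.trans h2.symm) hm
      · simp [h1, h2]
      · simp [h1, h2]
      · exact absurd (h1.trans h2.symm) hm
  refine inner_cosetVec_of_notMem fun hmem => h ?_
  rw [← map_add, regionGroup, Submodule.mem_comap, ext_res, add_add_add_comm, ← add_smul] at hmem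
  -- The crossing number with `z₁` can be taken with the loop `c` inside `R`, so it survives
  -- restriction to `R`; there it equals the difference of the charges.
  have hc : i.charge = i'.charge := by
    obtain ⟨c, -, hcR, hcz⟩ := hR
    obtain ⟨hd, hz⟩ := W.mem_fluxGroup.1 hmem
    have hw : T.IsDualLoop (u p + u p') :=
      (W.mem_fluxGroup.1 (add_mem (hu p) (hu p'))).1
    rw [pairing_comm, ← T.pairing_of_homologous hd hcz, pairing_comm, pairing_mask_comm,
      T.mask_eq_self hcR, pairing_add_right, pairing_smul_right, pairing_comm,
      T.pairing_of_homologous hw hcz, pairing_comm T c, T.pairing_of_homologous W.loop_x₂ hcz,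
      W.cross₂₁, mul_one, pairing_comm, (W.mem_fluxGroup.1 (add_mem (hu p) (hu p'))).2,
      zero_add] at hz
    exact CharTwo.add_eq_zero.1 hz
  rw [hc, CharTwo.add_self_eq_zero, zero_smul, add_zero] at hmem
  exact ⟨hsep p p' hmem, Flux.ext_of_charge_vortex hc hm⟩

/-! ### The Schmidt decomposition -/

/-- The state of flux `i` as a signed superposition of dual loops. -/
def LoopSystem.stateVec (W : T.LoopSystem) (i : Flux) : T.Hilb :=
  cosetVec W.fluxGroup (i.vortex • T.pairingHom W.z₂) (i.charge • W.x₂)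

variable {W : T.LoopSystem} {A : Finset T.Edge} {ι : Type*} {u : ι → T.Chain}

/-- `u` represents the cosets of the sum of the groups of the two regions in the flux group. -/
structure LoopSystem.IsTransversal (W : T.LoopSystem) (A : Finset T.Edge) (u : ι → T.Chain) :
    Prop where
  mem : ∀ p, u p ∈ W.fluxGroup
  unique : ∀ k ∈ W.fluxGroup, ∃! p, T.mask A (k + u p) ∈ W.fluxGroup

theorem LoopSystem.mask_compl_mem_iff {k : T.Chain} (hk : k ∈ W.fluxGroup) :
    T.mask Aᶜ k ∈ W.fluxGroup ↔ T.mask A k ∈ W.fluxGroup := by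
  have h : T.mask A k + T.mask Aᶜ k ∈ W.fluxGroup := by rwa [mask_add_mask_compl]
  exact ⟨fun h' => (W.fluxGroup.add_mem_iff_left h').1 h,
    fun h' => (W.fluxGroup.add_mem_iff_right h').1 h⟩

theorem LoopSystem.IsTransversal.eq_left (hu : W.IsTransversal A u) (p q : ι)
    (h : T.mask A (u p + u q) ∈ W.fluxGroup) : p = q := by
  refine (hu.unique (u p) (hu.mem p)).unique ?_ h
  rw [add_self_of_zmod_two, map_zero]
  exact zero_mem _

theorem LoopSystem.IsTransversal.eq_right (hu : W.IsTransversal A u) (p q : ι)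
    (h : T.mask Aᶜ (u p + u q) ∈ W.fluxGroup) : p = q :=
  hu.eq_left p q ((mask_compl_mem_iff (add_mem (hu.mem p) (hu.mem q))).1 h)

variable [Fintype ι]

/-- Each group element is uniquely a representative plus a part in each region. -/
theorem LoopSystem.IsTransversal.card (hu : W.IsTransversal A u) :
    Nat.card W.fluxGroup = Fintype.card ι * (Nat.card (W.regionGroup A) *
      Nat.card (W.regionGroup Aᶜ)) := by
  have hmA : ∀ a b, T.mask A (ext A a + ext Aᶜ b) = ext A a := fun a b => by
    have h := T.mask_compl_eq_zero (ext_eq_zero Aᶜ b)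
    rw [compl_compl] at h
    rw [map_add, T.mask_eq_self (ext_eq_zero A a), h, add_zero]
  let F : ι × (W.regionGroup A × W.regionGroup Aᶜ) → W.fluxGroup := fun x =>
    ⟨(ext A x.2.1.1 + ext Aᶜ x.2.2.1) + u x.1,
      add_mem (add_mem x.2.1.2 x.2.2.2) (hu.mem x.1)⟩
  have hF : Function.Bijective F := by
    constructor
    · rintro ⟨p, a, b⟩ ⟨q, a', b'⟩ h
      have h' : (ext A a.1 + ext Aᶜ b.1) + u p = (ext A a'.1 + ext Aᶜ b'.1) + u q :=
        congrArg Subtype.val h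
      have hpq : p = q := by
        refine (hu.unique _ (F (p, a, b)).2).unique ?_ ?_
        · change T.mask A ((ext A a.1 + ext Aᶜ b.1) + u p + u p) ∈ _
          rw [add_assoc, add_self_of_zmod_two, add_zero, hmA]
          exact a.2
        · change T.mask A ((ext A a.1 + ext Aᶜ b.1) + u p + u q) ∈ _
          rw [h', add_assoc, add_self_of_zmod_two, add_zero, hmA]
          exact a'.2
      subst hpq
      have h1 := add_right_cancel h'
      have h2 := congrArg (T.mask A) h1
      rw [hmA, hmA] at h2
      rw [h2] at h1
      rw [Subtype.ext (ext_injective A h2), Subtype.ext (ext_injective Aᶜ (add_left_cancel h1))]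
    · rintro ⟨k, hk⟩
      obtain ⟨p, hp, -⟩ := hu.unique k hk
      have hp' := (mask_compl_mem_iff (A := A) (add_mem hk (hu.mem p))).2 hp
      refine ⟨⟨p, ⟨res A (k + u p), ?_⟩, ⟨res Aᶜ (k + u p), ?_⟩⟩, Subtype.ext ?_⟩
      · rw [regionGroup, Submodule.mem_comap, ext_res]; exact hp
      · rw [regionGroup, Submodule.mem_comap, ext_res]; exact hp'
      · change ext A (res A (k + u p)) + ext Aᶜ (res Aᶜ (k + u p)) + u p = k
        rw [ext_res, ext_res, mask_add_mask_compl, add_assoc, add_self_of_zmod_two, add_zero]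
  rw [← Nat.card_eq_of_bijective F hF, Nat.card_prod, Nat.card_prod, Nat.card_eq_fintype_card]

/-- On the coset exactly one `p` contributes at each configuration. The sign factorizes because the
crossing number is additive over the regions, and the normalizations match by `IsTransversal.card`.
-/
theorem LoopSystem.IsTransversal.stateVec_eq (hu : W.IsTransversal A u) (i : Flux) :
    W.stateVec i = (((√(Fintype.card ι))⁻¹ : ℝ) : ℂ) •
      ∑ p, T.tensor A (W.regionVec A i (u p)) (W.regionVec Aᶜ i (u p)) := by
  classical
  ext s
  set t := s + i.charge • W.x₂ with ht
  have hterm : ∀ p, T.tensor A (W.regionVec A i (u p)) (W.regionVec Aᶜ i (u p)) s =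
      (((√(Nat.card (W.regionGroup A)))⁻¹ * (√(Nat.card (W.regionGroup Aᶜ)))⁻¹ : ℝ) : ℂ) *
        parity (i.vortex * T.pairing W.z₂ s) *
        if t ∈ W.fluxGroup ∧ T.mask A (t + u p) ∈ W.fluxGroup then 1 else 0 := by
    intro p
    change W.regionVec A i (u p) (res A s) * W.regionVec Aᶜ i (u p) (res Aᶜ s) = _
    rw [regionVec, regionVec, cosetVec_apply, cosetVec_apply, ← map_add, ← map_add]
    simp only [regionGroup, Submodule.mem_comap, ext_res, LinearMap.smul_apply,
      LinearMap.comp_apply, pairingHom_apply, smul_eq_mul]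
    have hs : s + (u p + i.charge • W.x₂) = t + u p := by rw [ht]; abel
    have hpar : parity (i.vortex * T.pairing W.z₂ s) =
        parity (i.vortex * T.pairing W.z₂ (T.mask A s)) *
          parity (i.vortex * T.pairing W.z₂ (T.mask Aᶜ s)) := by
      rw [← parity_add, ← mul_add, ← pairing_add_right, mask_add_mask_compl]
    have hiff : (t ∈ W.fluxGroup ∧ T.mask A (t + u p) ∈ W.fluxGroup) ↔
        (T.mask A (t + u p) ∈ W.fluxGroup ∧ T.mask Aᶜ (t + u p) ∈ W.fluxGroup) := by
      constructor
      · rintro ⟨h1, h2⟩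
        exact ⟨h2, (mask_compl_mem_iff (add_mem h1 (hu.mem p))).2 h2⟩
      · rintro ⟨h1, h2⟩
        refine ⟨(W.fluxGroup.add_mem_iff_left (hu.mem p)).1 ?_, h1⟩
        rw [← T.mask_add_mask_compl A (t + u p)]
        exact add_mem h1 h2
    rw [hs, hpar, Complex.ofReal_mul]
    simp only [hiff]
    by_cases h1 : T.mask A (t + u p) ∈ W.fluxGroup <;>
      by_cases h2 : T.mask Aᶜ (t + u p) ∈ W.fluxGroup <;>
      simp only [h1, h2, and_true, and_false, if_true, if_false, mul_zero, zero_mul, mul_one]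
    ring
  rw [PiLp.smul_apply, WithLp.ofLp_sum, Finset.sum_apply]
  simp only [hterm]
  rw [← Finset.mul_sum, stateVec, cosetVec_apply, hu.card]
  have hsum : (∑ p, if t ∈ W.fluxGroup ∧ T.mask A (t + u p) ∈ W.fluxGroup then (1 : ℂ) else 0) =
      if t ∈ W.fluxGroup then 1 else 0 := by
    by_cases h : t ∈ W.fluxGroup
    · obtain ⟨p, hp, hp'⟩ := hu.unique t h
      rw [if_pos h, Finset.sum_eq_single p]
      · rw [if_pos ⟨h, hp⟩]
      · exact fun q _ hq => if_neg fun hc => hq (hp' q hc.2)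
      · exact fun hc => absurd (Finset.mem_univ p) hc
    · simp [h]
  rw [hsum, LinearMap.smul_apply, pairingHom_apply, smul_eq_mul, smul_eq_mul]
  push_cast
  rw [Real.sqrt_mul (Nat.cast_nonneg _), Real.sqrt_mul (Nat.cast_nonneg _)]
  push_cast
  rw [mul_inv, mul_inv]
  ring

/-- Representatives are chosen preimages under `cutMap A`. Any enumeration of the image serves, so
the two indices need not refer to the individual components. -/
theorem LoopSystem.exists_isTransversal {Γ₁ Γ₂ : (T.boundaryGraph A).ConnectedComponent}
    (hA : T.IsAnnularBipartition W.z₁ A Γ₁ Γ₂) {μmax γmax : ℕ}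
    (hμ : μmax = 2 ^ (T.numPlaquettes A Γ₁ - 1)) (hγ : γmax = 2 ^ (T.numPlaquettes A Γ₂ - 1)) :
    ∃ u : Fin μmax × Fin γmax → T.Chain, W.IsTransversal A u := by
  have hcard := W.card_map_cutMap hA
  rw [← hμ, ← hγ] at hcard
  obtain ⟨σ⟩ : Nonempty (Fin μmax × Fin γmax ≃ W.fluxGroup.map (cutMap A)) :=
    Finite.card_eq.1 (by rw [hcard, Nat.card_prod, Nat.card_fin, Nat.card_fin])
  have hsec : ∀ p, ∃ k ∈ W.fluxGroup, cutMap A k = σ p := fun p => (σ p).2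
  choose u hu hσ using hsec
  refine ⟨u, hu, fun k hk => ⟨σ.symm ⟨_, k, hk, rfl⟩, ?_, fun p hp => ?_⟩⟩
  · change T.mask A _ ∈ W.fluxGroup
    rw [← W.cutMap_eq_zero_iff hA.winds_right, map_add, hσ, Equiv.apply_symm_apply]
    exact add_self_of_zmod_two _
  · rw [Equiv.eq_symm_apply]
    refine Subtype.ext ?_
    change T.mask A _ ∈ W.fluxGroup at hp
    rw [← W.cutMap_eq_zero_iff hA.winds_right, map_add, hσ] at hp
    exact (eq_neg_of_add_eq_zero_right hp).trans
      (neg_eq_of_add_eq_zero_left (add_self_of_zmod_two _))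

end TorusLattice

theorem Flux.sum_eq {M : Type*} [AddCommMonoid M] (g : Flux → M) :
    ∑ i, g i = g .one + (g .e + (g .m + g .em)) := by
  change ∑ i ∈ ({.one, .e, .m, .em} : Finset Flux), g i = _
  simp

namespace TorusLattice

variable {D : Type*} [Fintype D] {T : TorusLattice D}

/-! ### The states of definite flux -/

theorem zString_apply (c : T.Chain) (ψ : T.Hilb) (s : T.Chain) :
    T.zString c ψ s = parity (T.pairing c s) * ψ s := rfl

theorem halfProj_zString_apply (c : T.Chain) (ψ : T.Hilb) (s : T.Chain) :
    T.halfProj (T.zString c) ψ s = if T.pairing c s = 0 then ψ s else 0 := by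
  have h : T.halfProj (T.zString c) ψ s =
      2⁻¹ * (ψ s + parity (T.pairing c s) * ψ s) := rfl
  rw [h]
  rcases ZMod.two_cases (T.pairing c s) with h0 | h0 <;> simp [h0]
  ring

theorem noncommProd_halfProj_apply (F : Finset T.Face)
    (comm : (F : Set T.Face).Pairwise (Function.onFun Commute fun f => T.halfProj (T.plaqOp f)))
    (ψ : T.Hilb) (s : T.Chain) :
    F.noncommProd (fun f => T.halfProj (T.plaqOp f)) comm ψ s =
      if ∀ f ∈ F, T.pairing (T.bdry f) s = 0 then ψ s else 0 := by
  induction F using Finset.induction_on with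
  | empty =>
    rw [Finset.noncommProd_empty]
    simp
  | insert f F hf ih =>
    rw [Finset.noncommProd_insert_of_notMem _ _ _ _ hf, Module.End.mul_apply, plaqOp,
      halfProj_zString_apply, ih]
    simp only [Finset.forall_mem_insert, ite_and]

/-- The projectors are diagonal and together cut out the flux group; the scalar is the amplitude of
`plusState` times the norm of the group's indicator vector. -/
theorem LoopSystem.fluxVacuum_eq (W : T.LoopSystem) :
    T.fluxVacuum W = (((√2)⁻¹ ^ Fintype.card T.Edge * √(Nat.card W.fluxGroup) : ℝ) : ℂ) •
      W.stateVec .one := by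
  classical
  ext s
  refine (noncommProd_halfProj_apply _ _ _ s).trans ?_
  rw [halfProj_zString_apply, PiLp.smul_apply, stateVec,
    cosetVec_apply, smul_eq_mul]
  have hK : √(Nat.card W.fluxGroup : ℝ) ≠ 0 :=
    (Real.sqrt_pos.2 (Nat.cast_pos.2 Nat.card_pos)).ne'
  have hK' : ((√(Nat.card W.fluxGroup : ℝ) : ℝ) : ℂ) ≠ 0 := Complex.ofReal_ne_zero.2 hK
  have hmem : s + Flux.charge .one • W.x₂ ∈ W.fluxGroup ↔
      (∀ f ∈ Finset.univ, T.pairing (T.bdry f) s = 0) ∧ T.pairing W.z₁ s = 0 := by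
    rw [Flux.charge, zero_smul, add_zero, W.mem_fluxGroup]
    simp [IsDualLoop]
  have hplus : T.plusState s = (((√2)⁻¹ ^ Fintype.card T.Edge : ℝ) : ℂ) := by
    rw [plusState]; push_cast; rfl
  rw [hplus]
  simp only [hmem, ite_and, Flux.vortex, zero_smul, LinearMap.zero_apply, parity_zero, mul_one]
  push_cast
  split_ifs <;> field_simp <;> simp

theorem LoopSystem.norm_stateVec (W : T.LoopSystem) (i : Flux) : ‖W.stateVec i‖ = 1 :=
  norm_cosetVec _ _ _

theorem LoopSystem.stateVec_apply_add (W : T.LoopSystem) (i : Flux) {c : T.Chain}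
    (hc : c ∈ W.fluxGroup) (s : T.Chain) :
    W.stateVec i (s + c) = parity (i.vortex * T.pairing W.z₂ c) * W.stateVec i s := by
  classical
  have h : s + c + i.charge • W.x₂ ∈ W.fluxGroup ↔ s + i.charge • W.x₂ ∈ W.fluxGroup := by
    rw [add_right_comm]; exact W.fluxGroup.add_mem_iff_left hc
  simp only [stateVec, cosetVec_apply, h, map_add, LinearMap.smul_apply, pairingHom_apply,
    smul_eq_mul, parity_add]
  ring

theorem LoopSystem.xString_stateVec (W : T.LoopSystem) (i : Flux) {c : T.Chain}
    (hc : c ∈ W.fluxGroup) :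
    T.xString c (W.stateVec i) = parity (i.vortex * T.pairing W.z₂ c) • W.stateVec i := by
  ext s
  exact W.stateVec_apply_add i hc s

/-- The crossing number with `c` is constant, equal to `a`, on the coset that supports the state. -/
theorem LoopSystem.zString_stateVec (W : T.LoopSystem) (i : Flux) {c : T.Chain} {a : ZMod 2}
    (hc : ∀ k ∈ W.fluxGroup, T.pairing c k = 0) (ha : T.pairing c (i.charge • W.x₂) = a) :
    T.zString c (W.stateVec i) = parity a • W.stateVec i := by
  classical
  ext s
  rw [zString_apply, PiLp.smul_apply, smul_eq_mul, stateVec, cosetVec_apply]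
  by_cases h : s + i.charge • W.x₂ ∈ W.fluxGroup
  · have h' := hc _ h
    rw [pairing_add_right, ha, CharTwo.add_eq_zero] at h'
    rw [h']
  · simp [h]

theorem LoopSystem.fluxState_eq (W : T.LoopSystem) (i : Flux) : T.fluxState W i = W.stateVec i := by
  classical
  have hone : ((‖T.fluxVacuum W‖⁻¹ : ℝ) : ℂ) • T.fluxVacuum W = W.stateVec .one := by
    have hpos : 0 < (√2)⁻¹ ^ Fintype.card T.Edge * √(Nat.card W.fluxGroup) := by
      have : 0 < √(Nat.card W.fluxGroup : ℝ) := Real.sqrt_pos.2 (Nat.cast_pos.2 Nat.card_pos)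
      positivity
    rw [W.fluxVacuum_eq, norm_smul, W.norm_stateVec, mul_one, Complex.norm_real,
      Real.norm_of_nonneg hpos.le, smul_smul, ← Complex.ofReal_mul, inv_mul_cancel₀ hpos.ne',
      Complex.ofReal_one, one_smul]
  have hx : ∀ ψ : T.Hilb, ∀ s : T.Chain, T.xString W.x₂ ψ s = ψ (s + W.x₂) := fun _ _ => rfl
  cases i
  · exact hone
  · change T.xString W.x₂ (((‖T.fluxVacuum W‖⁻¹ : ℝ) : ℂ) • T.fluxVacuum W) = _
    rw [hone]
    ext s
    simp [hx, LoopSystem.stateVec, cosetVec_apply, Flux.charge, Flux.vortex]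
  · change T.zString W.z₂ (((‖T.fluxVacuum W‖⁻¹ : ℝ) : ℂ) • T.fluxVacuum W) = _
    rw [hone]
    ext s
    simp [zString_apply, LoopSystem.stateVec, cosetVec_apply, Flux.charge, Flux.vortex]
    ring_nf
  · change T.xString W.x₂ (T.zString W.z₂
      (((‖T.fluxVacuum W‖⁻¹ : ℝ) : ℂ) • T.fluxVacuum W)) = _
    rw [hone]
    ext s
    -- Since `x₂` and `z₂` cross evenly, translation by `x₂` does not disturb the sign.
    have hz : T.pairing W.z₂ (s + W.x₂) = T.pairing W.z₂ s := by
      rw [pairing_add_right, T.pairing_comm W.z₂ W.x₂, W.cross₂₂, add_zero]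
    simp [hx, zString_apply, hz, LoopSystem.stateVec, cosetVec_apply, Flux.charge, Flux.vortex]
    ring_nf

theorem LoopSystem.orthonormal_stateVec (W : T.LoopSystem) : Orthonormal ℂ W.stateVec := by
  refine ⟨W.norm_stateVec, fun i j hij => ?_⟩
  by_cases hm : j.vortex = i.vortex
  · refine inner_cosetVec_of_notMem fun h => hij ?_
    refine (Flux.ext_of_charge_vortex ?_ hm).symm
    rw [← add_smul] at h
    have h' := (W.mem_fluxGroup.1 h).2
    rw [pairing_smul_right, pairing_comm, W.cross₂₁, mul_one] at h'
    exact CharTwo.add_eq_zero.1 h'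
  · refine inner_cosetVec_of_ne W.x₁_mem_fluxGroup ?_
    rw [LinearMap.add_apply, LinearMap.smul_apply, LinearMap.smul_apply, pairingHom_apply,
      pairing_comm, W.cross₁₂]
    rcases ZMod.two_cases i.vortex with h1 | h1 <;> rcases ZMod.two_cases j.vortex with h2 | h2
    · exact absurd (h2.trans h1.symm) hm
    · simp [h1, h2]
    · simp [h1, h2]
    · exact absurd (h2.trans h1.symm) hm

/-! ### The ground states -/

/-- The common eigenspace of the star and plaquette operators for the eigenvalue `1`. -/
def codeSpace (T : TorusLattice D) : Submodule ℂ T.Hilb where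
  carrier := {ψ | (∀ v, T.starOp v ψ = ψ) ∧ ∀ f, T.plaqOp f ψ = ψ}
  zero_mem' := by simp
  add_mem' := fun ha hb => ⟨fun v => by rw [map_add, ha.1, hb.1], fun f => by
    rw [map_add, ha.2, hb.2]⟩
  smul_mem' := fun c _ ha => ⟨fun v => by rw [map_smul, ha.1], fun f => by rw [map_smul, ha.2]⟩

theorem LoopSystem.stateVec_mem_codeSpace (W : T.LoopSystem) (i : Flux) :
    W.stateVec i ∈ T.codeSpace := by
  constructor
  · intro v
    rw [starOp, W.xString_stateVec i (W.legs_mem_fluxGroup v), pairing_comm, W.loop_z₂ v, mul_zero,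
      parity_zero, one_smul]
  · intro f
    rw [plaqOp, W.zString_stateVec i (a := 0) (fun k hk => (W.mem_fluxGroup.1 hk).1 f),
      parity_zero, one_smul]
    rw [pairing_smul_right, W.loop_x₂ f, mul_zero]

/-- The lowest energy. -/
def groundEnergy (T : TorusLattice D) (U J : ℝ) : ℝ :=
  -(U * Fintype.card T.Vertex + J * Fintype.card T.Face)

theorem hamiltonian_apply (U J : ℝ) (ψ : T.Hilb) : T.hamiltonian U J ψ =
    -((U : ℂ) • ∑ v, T.starOp v ψ) - (J : ℂ) • ∑ f, T.plaqOp f ψ := by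
  simp [hamiltonian, LinearMap.sum_apply]

theorem hamiltonian_of_mem_codeSpace {ψ : T.Hilb} (h : ψ ∈ T.codeSpace) (U J : ℝ) :
    T.hamiltonian U J ψ = (T.groundEnergy U J : ℂ) • ψ := by
  rw [hamiltonian_apply, Finset.sum_congr rfl fun v _ => h.1 v,
    Finset.sum_congr rfl fun f _ => h.2 f, Finset.sum_const, Finset.sum_const, Finset.card_univ,
    Finset.card_univ, groundEnergy, ← Nat.cast_smul_eq_nsmul ℂ, ← Nat.cast_smul_eq_nsmul ℂ,
    smul_smul, smul_smul]
  push_cast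
  module

/-! ### The energy bound and its equality case -/

theorem norm_xString (c : T.Chain) (ψ : T.Hilb) : ‖T.xString c ψ‖ = ‖ψ‖ := by
  rw [EuclideanSpace.norm_eq, EuclideanSpace.norm_eq]
  congr 1
  exact Equiv.sum_comp (Equiv.addRight c) fun s => ‖ψ s‖ ^ 2

theorem norm_zString (c : T.Chain) (ψ : T.Hilb) : ‖T.zString c ψ‖ = ‖ψ‖ := by
  rw [EuclideanSpace.norm_eq, EuclideanSpace.norm_eq]
  congr 1
  refine Finset.sum_congr rfl fun s _ => ?_
  rw [zString_apply, norm_mul]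
  rcases ZMod.two_cases (T.pairing c s) with h | h <;> simp [h]

/-- The excess energy is a sum of one defect per star and plaquette. Each defect is nonnegative
because the operators are isometries, and it vanishes only on vectors that the operator fixes. -/
theorem re_inner_hamiltonian_sub (U J : ℝ) (ψ : T.Hilb) :
    (inner ℂ ψ (T.hamiltonian U J ψ)).re - T.groundEnergy U J * ‖ψ‖ ^ 2 =
      U * ∑ v, (‖ψ‖ ^ 2 - (inner ℂ ψ (T.starOp v ψ)).re) +
        J * ∑ f, (‖ψ‖ ^ 2 - (inner ℂ ψ (T.plaqOp f ψ)).re) := by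
  rw [hamiltonian_apply, inner_sub_right, inner_neg_right, inner_smul_right, inner_smul_right,
    inner_sum, inner_sum, Complex.sub_re, Complex.neg_re, Complex.re_ofReal_mul,
    Complex.re_ofReal_mul, Complex.re_sum, Complex.re_sum, Finset.sum_sub_distrib,
    Finset.sum_sub_distrib, Finset.sum_const, Finset.sum_const, Finset.card_univ, Finset.card_univ,
    groundEnergy, nsmul_eq_mul, nsmul_eq_mul]
  ring

theorem re_inner_le_of_norm_eq {ψ φ : T.Hilb} (h : ‖φ‖ = ‖ψ‖) : (inner ℂ ψ φ).re ≤ ‖ψ‖ ^ 2 := by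
  have := re_inner_le_norm (𝕜 := ℂ) ψ φ
  rw [h, ← sq] at this
  exact this

theorem eq_of_re_inner_eq {ψ φ : T.Hilb} (h : ‖φ‖ = ‖ψ‖) (h' : ‖ψ‖ ^ 2 - (inner ℂ ψ φ).re = 0) :
    φ = ψ := by
  have h1 := norm_sub_sq (𝕜 := ℂ) ψ φ
  rw [h, RCLike.re_eq_complex_re] at h1
  have h2 : ‖ψ - φ‖ ^ 2 = 0 := by linarith
  exact (sub_eq_zero.1 (norm_eq_zero.1 (pow_eq_zero_iff two_ne_zero |>.1 h2))).symm

theorem star_defect_nonneg (ψ : T.Hilb) (v : T.Vertex) :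
    0 ≤ ‖ψ‖ ^ 2 - (inner ℂ ψ (T.starOp v ψ)).re :=
  sub_nonneg.2 (re_inner_le_of_norm_eq (norm_xString _ ψ))

theorem plaq_defect_nonneg (ψ : T.Hilb) (f : T.Face) :
    0 ≤ ‖ψ‖ ^ 2 - (inner ℂ ψ (T.plaqOp f ψ)).re :=
  sub_nonneg.2 (re_inner_le_of_norm_eq (norm_zString _ ψ))

variable {U J : ℝ}

theorem groundEnergy_le (hU : 0 < U) (hJ : 0 < J) (ψ : T.Hilb) :
    T.groundEnergy U J * ‖ψ‖ ^ 2 ≤ (inner ℂ ψ (T.hamiltonian U J ψ)).re := by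
  have h := T.re_inner_hamiltonian_sub U J ψ
  have h1 := mul_nonneg hU.le (Finset.sum_nonneg fun v (_ : v ∈ Finset.univ) =>
    star_defect_nonneg ψ v)
  have h2 := mul_nonneg hJ.le (Finset.sum_nonneg fun f (_ : f ∈ Finset.univ) =>
    plaq_defect_nonneg ψ f)
  linarith

theorem mem_codeSpace_of_le (hU : 0 < U) (hJ : 0 < J) {ψ : T.Hilb}
    (hψ : (inner ℂ ψ (T.hamiltonian U J ψ)).re ≤ T.groundEnergy U J * ‖ψ‖ ^ 2) :
    ψ ∈ T.codeSpace := by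
  have h := T.re_inner_hamiltonian_sub U J ψ
  have hv := Finset.sum_nonneg fun v (_ : v ∈ Finset.univ) => star_defect_nonneg ψ v
  have hf := Finset.sum_nonneg fun f (_ : f ∈ Finset.univ) => plaq_defect_nonneg ψ f
  have h1 := mul_nonneg hU.le hv
  have h2 := mul_nonneg hJ.le hf
  have h3 := (mul_eq_zero.1 (le_antisymm (by linarith) h1)).resolve_left hU.ne'
  have h4 := (mul_eq_zero.1 (le_antisymm (by linarith) h2)).resolve_left hJ.ne'
  rw [Finset.sum_eq_zero_iff_of_nonneg fun v _ => star_defect_nonneg ψ v] at h3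
  rw [Finset.sum_eq_zero_iff_of_nonneg fun f _ => plaq_defect_nonneg ψ f] at h4
  exact ⟨fun v => eq_of_re_inner_eq (norm_xString _ ψ) (h3 v (Finset.mem_univ v)),
    fun f => eq_of_re_inner_eq (norm_zString _ ψ) (h4 f (Finset.mem_univ f))⟩

theorem re_inner_of_eigenvector {E : ℝ} {ψ : T.Hilb} (h : T.hamiltonian U J ψ = (E : ℂ) • ψ) :
    (inner ℂ ψ (T.hamiltonian U J ψ)).re = E * ‖ψ‖ ^ 2 := by
  rw [h, inner_smul_right, Complex.re_ofReal_mul, inner_self_eq_norm_sq_to_K]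
  norm_cast

theorem isGroundState_of_mem_codeSpace (hU : 0 < U) (hJ : 0 < J) {ψ : T.Hilb}
    (hψ : ψ ∈ T.codeSpace) (h1 : ‖ψ‖ = 1) : T.IsGroundState U J ψ := by
  refine ⟨h1, T.groundEnergy U J, hamiltonian_of_mem_codeSpace hψ U J, fun E hE => ?_⟩
  obtain ⟨φ, hφ⟩ := hE.exists_hasEigenvector
  have h := groundEnergy_le hU hJ φ
  rw [re_inner_of_eigenvector hφ.apply_eq_smul] at h
  have hpos : 0 < ‖φ‖ := norm_pos_iff.2 hφ.2
  exact le_of_mul_le_mul_right h (by positivity)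

theorem LoopSystem.mem_codeSpace_of_isGroundState (W : T.LoopSystem) (hU : 0 < U) (hJ : 0 < J)
    {ψ : T.Hilb} (hψ : T.IsGroundState U J ψ) : ψ ∈ T.codeSpace := by
  obtain ⟨-, E₀, hE, hmin⟩ := hψ
  refine mem_codeSpace_of_le hU hJ ?_
  rw [re_inner_of_eigenvector hE]
  -- The state of trivial flux attains the bound, so the lowest eigenvalue is at most
  -- `groundEnergy`.
  refine mul_le_mul_of_nonneg_right (hmin _ ?_) (sq_nonneg _)
  have hne : W.stateVec .one ≠ 0 := fun h => by
    have := W.norm_stateVec .one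
    rw [h, norm_zero] at this
    exact zero_ne_one this
  exact Module.End.hasEigenvalue_of_hasEigenvector ⟨Module.End.mem_eigenspace_iff.2
    (hamiltonian_of_mem_codeSpace (W.stateVec_mem_codeSpace .one) U J), hne⟩

/-! ### Definite-flux states span the code space -/

theorem apply_add_starSum {ψ : T.Hilb} (hψ : ψ ∈ T.codeSpace) (S : T.Vertex → ZMod 2)
    (s : T.Chain) : ψ (s + T.starSum S) = ψ s := by
  have hlegs : ∀ v s, ψ (s + T.legs v) = ψ s := fun v s =>
    congrArg (fun φ : T.Hilb => φ s) (hψ.1 v)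
  have : ∀ (F : Finset T.Vertex) (s : T.Chain), ψ (s + ∑ v ∈ F, S v • T.legs v) = ψ s := by
    intro F
    induction F using Finset.induction_on with
    | empty => intro s; rw [Finset.sum_empty, add_zero]
    | insert v F hv ih =>
      intro s
      rw [Finset.sum_insert hv, ← add_assoc, ih]
      rcases ZMod.two_cases (S v) with h | h
      · rw [h, zero_smul, add_zero]
      · rw [h, one_smul, hlegs]
  exact this Finset.univ s

/-- Plaquette conditions kill `ψ` off the dual loops, and star conditions make it constant modulo
stars, which leaves four values. -/
theorem LoopSystem.eq_zero_of_mem_codeSpace (W : T.LoopSystem) {ψ : T.Hilb}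
    (hψ : ψ ∈ T.codeSpace) (h : ∀ a b : ZMod 2, ψ (a • W.x₁ + b • W.x₂) = 0) : ψ = 0 := by
  ext s
  by_cases hs : T.IsDualLoop s
  · obtain ⟨S, a, b, rfl⟩ := W.exists_eq_of_isDualLoop hs
    rw [add_comm, apply_add_starSum hψ, h]
    rfl
  · rw [IsDualLoop, not_forall] at hs
    obtain ⟨f, hf⟩ := hs
    have h1 : T.plaqOp f ψ s = ψ s := by rw [hψ.2 f]
    rw [plaqOp, zString_apply, (ZMod.two_cases _).resolve_left hf, parity_one, neg_one_mul] at h1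
    exact self_eq_neg.1 h1.symm

theorem LoopSystem.stateVec_apply (W : T.LoopSystem) (i : Flux) (a b : ZMod 2) :
    W.stateVec i (a • W.x₁ + b • W.x₂) = (((√(Nat.card W.fluxGroup))⁻¹ : ℝ) : ℂ) *
      parity (i.vortex * a) * if b = i.charge then 1 else 0 := by
  have hmem : a • W.x₁ + b • W.x₂ + i.charge • W.x₂ ∈ W.fluxGroup ↔ b = i.charge := by
    rw [add_assoc, ← add_smul,
      W.fluxGroup.add_mem_iff_right (W.fluxGroup.smul_mem a W.x₁_mem_fluxGroup)]
    constructor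
    · intro h
      have h' := (W.mem_fluxGroup.1 h).2
      rw [pairing_smul_right, pairing_comm, W.cross₂₁, mul_one] at h'
      exact CharTwo.add_eq_zero.1 h'
    · rintro rfl
      rw [CharTwo.add_self_eq_zero, zero_smul]
      exact zero_mem _
  rw [stateVec, cosetVec_apply]
  simp only [hmem, LinearMap.smul_apply, pairingHom_apply, pairing_add_right, pairing_smul_right,
    T.pairing_comm W.z₂ W.x₁, T.pairing_comm W.z₂ W.x₂, W.cross₁₂, W.cross₂₂, mul_one, mul_zero,
    add_zero, smul_eq_mul]

theorem LoopSystem.exists_eq_sum_of_mem_codeSpace (W : T.LoopSystem) {ψ : T.Hilb}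
    (hψ : ψ ∈ T.codeSpace) : ∃ c : Flux → ℂ, ψ = ∑ i, c i • W.stateVec i := by
  set N : ℂ := ((√(Nat.card W.fluxGroup) : ℝ) : ℂ) with hN
  have hN0 : N ≠ 0 :=
    Complex.ofReal_ne_zero.2 (Real.sqrt_pos.2 (Nat.cast_pos.2 Nat.card_pos)).ne'
  -- Fourier inversion in `a`: by `stateVec_apply` the state of flux `i` has the value `parity
  -- (i.vortex * a) / N` where `b` is its charge, and zero otherwise.
  refine ⟨fun i => N / 2 * (ψ ((0 : ZMod 2) • W.x₁ + i.charge • W.x₂) +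
    parity i.vortex * ψ ((1 : ZMod 2) • W.x₁ + i.charge • W.x₂)), ?_⟩
  rw [← sub_eq_zero]
  refine W.eq_zero_of_mem_codeSpace (sub_mem hψ (sum_mem fun i _ =>
    Submodule.smul_mem _ _ (W.stateVec_mem_codeSpace i))) fun a b => ?_
  rw [PiLp.sub_apply, WithLp.ofLp_sum, Finset.sum_apply, Flux.sum_eq]
  simp only [PiLp.smul_apply, smul_eq_mul, W.stateVec_apply, Flux.charge, Flux.vortex,
    Complex.ofReal_inv, ← hN]
  rcases ZMod.two_cases a with rfl | rfl <;> rcases ZMod.two_cases b with rfl | rfl <;>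
    simp <;> field_simp <;> ring

theorem sum_norm_sq_of_norm_sum_eq_one {c : Flux → ℂ} {v : Flux → T.Hilb}
    (hv : Orthonormal ℂ v) (h : ‖∑ i, c i • v i‖ = 1) : ∑ i, ‖c i‖ ^ 2 = 1 := by
  have h1 := hv.inner_sum c c Finset.univ
  rw [inner_self_eq_norm_sq_to_K, h] at h1
  simp only [RCLike.conj_mul, RCLike.ofReal_one, one_pow] at h1
  refine Complex.ofReal_injective ?_
  push_cast
  exact h1.symm

end TorusLattice

end

/-! ### Assembly of the Schmidt decompositions -/

theorem mainTheorem8 {D : Type*} [Fintype D] (T : TorusLattice D) (W : T.LoopSystem)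
    (A : Finset T.Edge) (Γ₁ Γ₂ : (T.boundaryGraph A).ConnectedComponent)
    (hA : T.IsAnnularBipartition W.z₁ A Γ₁ Γ₂)
    (μmax γmax : ℕ) (hμ : μmax = 2 ^ (T.numPlaquettes A Γ₁ - 1))
    (hγ : γmax = 2 ^ (T.numPlaquettes A Γ₂ - 1)) :
    ∃ (e : Flux → Fin μmax → Fin γmax → T.RegionHilb A)
      (f : Flux → Fin μmax → Fin γmax → T.RegionHilb Aᶜ),
      -- the Schmidt vectors are orthonormal, also across different fluxes
      (∀ i i' μ μ' γ γ', inner ℂ (e i' μ' γ') (e i μ γ) =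
        if μ = μ' ∧ γ = γ' ∧ i = i' then 1 else 0) ∧
      (∀ i i' μ μ' γ γ', inner ℂ (f i' μ' γ') (f i μ γ) =
        if μ = μ' ∧ γ = γ' ∧ i = i' then 1 else 0) ∧
      -- the Schmidt decomposition of each ground state of definite flux
      (∀ i, T.fluxState W i =
        (((μmax : ℝ) ^ (-(1 / 2) : ℝ) * (γmax : ℝ) ^ (-(1 / 2) : ℝ) : ℝ) : ℂ) •
          ∑ μ, ∑ γ, T.tensor A (e i μ γ) (f i μ γ)) ∧
      -- the states of definite flux are ground states and eigenstates of `W^z₁` and `W^x₁`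
      (∀ U J : ℝ, 0 < U → 0 < J → ∀ i, T.IsGroundState U J (T.fluxState W i)) ∧
      (∀ i, T.zString W.z₁ (T.fluxState W i) = TorusLattice.fluxZ i • T.fluxState W i ∧
        T.xString W.x₁ (T.fluxState W i) = TorusLattice.fluxX i • T.fluxState W i) ∧
      -- the Schmidt decomposition of a general ground state
      (∀ U J : ℝ, 0 < U → 0 < J → ∀ ψ : T.Hilb, T.IsGroundState U J ψ →
        ∃ c : Flux → ℂ, ψ = ∑ i, c i • T.fluxState W i ∧ ∑ i, ‖c i‖ ^ 2 = 1 ∧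
          ψ = ∑ i, c i • ∑ μ, ∑ γ,
            (((μmax : ℝ) ^ (-(1 / 2) : ℝ) * (γmax : ℝ) ^ (-(1 / 2) : ℝ) : ℝ) : ℂ) •
              T.tensor A (e i μ γ) (f i μ γ)) := by
  obtain ⟨u, hu⟩ := TorusLattice.LoopSystem.exists_isTransversal hA hμ hγ
  have hcut : ∀ d, T.IsCut Aᶜ d ↔ T.IsCut A d := fun d => by
    simp only [TorusLattice.IsCut, Finset.mem_compl, not_iff_not]
  have hcc : T.WindsAlong W.z₁ Aᶜᶜ := by rw [compl_compl]; exact hA.winds_left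
  have hschmidt : ∀ i, T.fluxState W i =
      (((μmax : ℝ) ^ (-(1 / 2) : ℝ) * (γmax : ℝ) ^ (-(1 / 2) : ℝ) : ℝ) : ℂ) •
        ∑ μ, ∑ γ, T.tensor A (W.regionVec A i (u (μ, γ))) (W.regionVec Aᶜ i (u (μ, γ))) := by
    intro i
    rw [W.fluxState_eq, hu.stateVec_eq, Fintype.sum_prod_type, Fintype.card_prod, Fintype.card_fin,
      Fintype.card_fin, Real.rpow_neg (Nat.cast_nonneg _), Real.rpow_neg (Nat.cast_nonneg _),
      ← Real.sqrt_eq_rpow, ← Real.sqrt_eq_rpow, Nat.cast_mul, Real.sqrt_mul (Nat.cast_nonneg _),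
      mul_inv]
  refine ⟨fun i μ γ => W.regionVec A i (u (μ, γ)), fun i μ γ => W.regionVec Aᶜ i (u (μ, γ)),
    fun i i' μ μ' γ γ' => ?_, fun i i' μ μ' γ γ' => ?_, hschmidt, fun U J hU hJ i => ?_,
    fun i => ?_, fun U J hU hJ ψ hψ => ?_⟩
  · rw [W.inner_regionVec hA.simple_vertex hA.winds_left hA.winds_right hu.mem hu.eq_left]
    simp only [Prod.mk.injEq, and_assoc]
  · rw [W.inner_regionVec (R := Aᶜ) (fun v => by simpa only [hcut] using hA.simple_vertex v)
      hA.winds_right hcc hu.mem hu.eq_right]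
    simp only [Prod.mk.injEq, and_assoc]
  · rw [W.fluxState_eq]
    exact TorusLattice.isGroundState_of_mem_codeSpace hU hJ (W.stateVec_mem_codeSpace i)
      (W.norm_stateVec i)
  · rw [W.fluxState_eq, W.zString_stateVec i (a := i.charge)
      (fun k hk => (W.mem_fluxGroup.1 hk).2)
      (by rw [T.pairing_smul_right, T.pairing_comm, W.cross₂₁, mul_one]),
      W.xString_stateVec i W.x₁_mem_fluxGroup, T.pairing_comm, W.cross₁₂, mul_one]
    cases i <;> simp [Flux.charge, Flux.vortex, TorusLattice.fluxZ, TorusLattice.fluxX]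
  · obtain ⟨c, hc⟩ := W.exists_eq_sum_of_mem_codeSpace (W.mem_codeSpace_of_isGroundState hU hJ hψ)
    refine ⟨c, ?_, TorusLattice.sum_norm_sq_of_norm_sum_eq_one
      W.orthonormal_stateVec (hc ▸ hψ.1), ?_⟩
    · simpa only [W.fluxState_eq] using hc
    · simp only [← Finset.smul_sum, ← hschmidt, W.fluxState_eq]
      exact hc
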